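/- **Setting.** Let $\Lambda$ be a square domain with free or periodic boundary conditions: for $L>1$, either the $L\times L$ grid graph on $\{0,\dots,L-1\}^2$, or, for $L$ even, the discrete torus on the same vertex set. Write $\operatorname{dist}$ for the graph distance (for sets, the minimal distance between their points), $j\sim\ell$ for adjacency, $(\Delta_\Lambda f)(j)=\sum_{\ell\sim j}(f_\ell-f_j)$, and $\operatorname{supp}f=\{j: f_j\ne0\}$. Fix $3/2<\alpha<2$, $M=2^{16}$. A *density* is a function $\varrho:\Lambda\to\mathbb Z$ that is not identically zero. Put $d(\varrho)=\max_{i,j\in\operatorname{supp}\varrho}\operatorname{dist}(i,j)$, $Q(\varrho)=\sum_j\varrho(j)$, $\|\varrho\|_2^2=\sum_j\varrho(j)^2$ and $\operatorname{dist}(\varrho_1,\varrho_2)=\operatorname{dist}(\operatorname{supp}\varrho_1,\operatorname{supp}\varrho_2)$; $\varrho$ is *neutral* if $Q(\varrho)=0$. For each density fix (arbitrarily) a center $j_\varrho\in\operatorname{supp}\varrho$ such that $d(\varrho)=\operatorname{dist}(j_\varrho,k)$ for some $k\in\operatorname{supp}\varrho$, and let $$D(\varrho)=\{\ell:\operatorname{dist}(\ell,j_\varrho)<2d(\varrho)\},\qquad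 D^+(\varrho)=\{j:\operatorname{dist}(j,D(\varrho))\le1\}.$$ A *$2^k\times2^k$ square* is a set of the form $\{(c,d)\in\Lambda: c-a,\ d-b\in\{0,\dots,2^k-1\}\}$ with $(a,b)\in\Lambda$ (differences taken modulo $L$ in the periodic case), required to have $2^{2k}$ points if $2^k\le L$ and to be equal to $\Lambda$ if $2^k>L$. For each density $\varrho$ and $k\ge0$ fix (arbitrarily) a collection $\mathscr S_k(\varrho)$ of $2^k\times2^k$ squares covering $\operatorname{supp}\varrho$ of minimal cardinality. For $k\ge1$ let $\mathscr S^{\rm sep}_k(\varrho)=\emptyset$ if $|\mathscr S_k(\varrho)|=1$, and otherwise $$\mathscr S^{\rm sep}_k(\varrho)=\{s\in\mathscr S_k(\varrho):\operatorname{dist}(s',s)\ge 2M2^{\alpha(k+1)}\ \text{ for all } s'\in\mathscr S_k(\varrho)\setminus\{s\}\}.$$ For $\beta>0$ and $a:\Lambda\to\mathbb R$ let $E_\beta(a,\varrho)=\sum_j a_j\varrho(j)-\frac\beta2\sum_{j\sim\ell}(a_j-a_\ell)^2$, each edge being counted once. Let $\mathscr N$ be an *ensemble*, that is, a finite (possibly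 empty) collection of densities with mutually disjoint supports, such that: (a) $\mathscr N$ contains at most one non-neutral density; (b) distinct $\varrho_1,\varrho_2\in\mathscr N$ satisfy $\operatorname{dist}(\varrho_1,\varrho_2)\ge M[\min(d(\varrho_1),d(\varrho_2))]^\alpha$, and if $\varrho_c\in\mathscr N$ is non-neutral then $\operatorname{dist}(\varrho,\varrho_c)\ge M[d(\varrho)]^\alpha$ for all $\varrho\in\mathscr N$, $\varrho\ne\varrho_c$; (c) whenever a neutral $\varrho\in\mathscr N$ is written as $\varrho=\varrho_1+\varrho_2$ with densities $\varrho_1,\varrho_2$ of disjoint supports and $\operatorname{dist}(\varrho_1,\varrho_2)\ge 2M[\min(d(\varrho_1),d(\varrho_2))]^\alpha$, both $\varrho_1$ and $\varrho_2$ are non-neutral. Let $\mathscr N_0$ be the set of neutral densities of $\mathscr N$, and for $\varrho\in\mathscr N_0$ let $\mathscr N_0(\varrho)=\{\varrho'\in\mathscr N_0: d(\varrho')\le 2d(\varrho),\ \varrho'\ne\varrho\}$. **Proposition (Spin Wave Existence).** There is a constant $D_3>0$, depending only on the fixed $\alpha$ (in particular not on $\Lambda$, $\beta$, $\mathscr N$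 or the choices of centers and coverings), such that for each $\varrho\in\mathscr N_0$ there exists $a_\varrho:\Lambda\to\mathbb R$ with the following properties: 1. for every $\varrho'\in\mathscr N_0(\varrho)$, $a_\varrho$ is constant on $D^+(\varrho')$; 2. $\operatorname{supp}a_\varrho\subseteq D(\varrho)$, and $\operatorname{supp}a_\varrho$ is disjoint from $\operatorname{supp}\varrho'$ for every $\varrho'\in\mathscr N_0\setminus\mathscr N_0(\varrho)$ with $\varrho'\ne\varrho$; 3. $\operatorname{supp}(\Delta_\Lambda a_\varrho)\subseteq D(\varrho)$; 4. the sum $\sum_{k\ge1}|\mathscr S^{\rm sep}_k(\varrho)|$ is finite and $$E_\beta(a_\varrho,\varrho)\ \ge\ \frac1\beta\Big(\frac1{16}\|\varrho\|_2^2+D_3\sum_{k=1}^\infty|\mathscr S^{\rm sep}_k(\varrho)|\Big).$$ -/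

import Mathlib

namespace SpinWave

/-! ### Square domains -/

/-- The two kinds of boundary conditions under consideration. -/
inductive BoundaryCondition
  | free
  | periodic

/-- The square domain of side `L`, with vertex set `{0, …, L-1}²`.  With free boundary conditions
it is the `L × L` grid (the product of two paths), with periodic boundary conditions it is the
discrete torus (the product of two cycles). -/
def squareDomain (bc : BoundaryCondition) (L : ℕ) : SimpleGraph (Fin L × Fin L) :=
  match bc with
  | .free => SimpleGraph.boxProd (SimpleGraph.pathGraph L) (SimpleGraph.pathGraph L)
  | .periodic => SimpleGraph.boxProd (SimpleGraph.cycleGraph L) (SimpleGraph.cycleGraph L)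

/-- The set of vertices `(c, d)` such that `c - a` and `d - b` (reduced modulo `L` for periodic
boundary conditions) belong to `{0, …, w - 1}`, where `p = (a, b)`. -/
def box (bc : BoundaryCondition) (L w : ℕ) (p : Fin L × Fin L) : Finset (Fin L × Fin L) :=
  match bc with
  | .free => {q | (p.1.val ≤ q.1.val ∧ q.1.val < p.1.val + w) ∧
      (p.2.val ≤ q.2.val ∧ q.2.val < p.2.val + w)}
  | .periodic => {q | ((q.1.val : ℤ) - (p.1.val : ℤ)) % (L : ℤ) < (w : ℤ) ∧
      ((q.2.val : ℤ) - (p.2.val : ℤ)) % (L : ℤ) < (w : ℤ)}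

/-- `s` is a `2^k × 2^k` square of the square domain.  It has `2^k · 2^k` points, unless `2^k > L`,
in which case it is the whole domain. -/
def IsSquare (bc : BoundaryCondition) (L k : ℕ) (s : Finset (Fin L × Fin L)) : Prop :=
  (∃ p, s = box bc L (2 ^ k) p) ∧
    if 2 ^ k ≤ L then s.card = 2 ^ k * 2 ^ k else s = Finset.univ

section Graph

variable {V : Type*} [Fintype V] [DecidableEq V]

/-- Graph distance between two sets of vertices; only used for non-empty sets, where it is the
minimum of the distances between their points. -/
noncomputable def setDist (G : SimpleGraph V) (A B : Finset V) : ℕ :=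
  sInf {n | ∃ i ∈ A, ∃ j ∈ B, G.dist i j = n}

open Classical in
/-- The finite difference Laplacian `(Δ f)(j) = ∑_{l ∼ j} (f l - f j)`. -/
noncomputable def laplacian (G : SimpleGraph V) (f : V → ℝ) (j : V) : ℝ :=
  ∑ l, if G.Adj j l then f l - f j else 0

open Classical in
/-- `∑_{j ∼ l} (a j - a l)²`, each edge counted once (the double sum over ordered pairs counts
every edge twice). -/
noncomputable def dirichlet (G : SimpleGraph V) (a : V → ℝ) : ℝ :=
  (∑ j, ∑ l, if G.Adj j l then (a j - a l) ^ 2 else 0) / 2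

/-! ### Densities.  A charge density is a function `ρ : V → ℤ` with `ρ ≠ 0`. -/

/-- The support of an integer valued function. -/
def supp (ρ : V → ℤ) : Finset V := {j | ρ j ≠ 0}

/-- The diameter of the support. -/
noncomputable def diam (G : SimpleGraph V) (ρ : V → ℤ) : ℕ :=
  (supp ρ ×ˢ supp ρ).sup fun p => G.dist p.1 p.2

/-- The total charge. -/
def charge (ρ : V → ℤ) : ℤ := ∑ j, ρ j

/-- The Euclidean norm of a density. -/
noncomputable def norm₂ (ρ : V → ℤ) : ℝ := Real.sqrt (∑ j, (ρ j : ℝ) ^ 2)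

/-- The distance between (the supports of) two densities. -/
noncomputable def chargeDist (G : SimpleGraph V) (ρ₁ ρ₂ : V → ℤ) : ℕ :=
  setDist G (supp ρ₁) (supp ρ₂)

/-- `E_β(a, ρ) = ⟨a, ρ⟩ - (β/2) ∑_{j ∼ l} (a j - a l)²`. -/
noncomputable def energy (G : SimpleGraph V) (β : ℝ) (a : V → ℝ) (ρ : V → ℤ) : ℝ :=
  (∑ j, a j * (ρ j : ℝ)) - β / 2 * dirichlet G a

/-- `center` selects, for every density `ρ`, a point of its support that realizes the diameter
together with some other point of the support. -/
def IsCenterChoice (G : SimpleGraph V) (center : (V → ℤ) → V) : Prop :=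
  ∀ ρ : V → ℤ, ρ ≠ 0 →
    center ρ ∈ supp ρ ∧ ∃ k ∈ supp ρ, diam G ρ = G.dist (center ρ) k

/-- `D(ρ)`: the points at distance less than `2 d(ρ)` from the chosen center. -/
def D (G : SimpleGraph V) (center : (V → ℤ) → V) (ρ : V → ℤ) : Set V :=
  {l | G.dist l (center ρ) < 2 * diam G ρ}

/-- `D⁺(ρ)`: the points at distance at most `1` from `D(ρ)`. -/
def DPlus (G : SimpleGraph V) (center : (V → ℤ) → V) (ρ : V → ℤ) : Set V :=
  {j | ∃ i ∈ D G center ρ, G.dist j i ≤ 1}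

/-- The constant `M`. -/
def M : ℝ := 2 ^ 16

/-! ### Ensembles -/

/-- A finite collection of densities with mutually disjoint supports. -/
def IsEnsemble (N : Finset (V → ℤ)) : Prop :=
  (∀ ρ ∈ N, ρ ≠ 0) ∧ ∀ ρ₁ ∈ N, ∀ ρ₂ ∈ N, ρ₁ ≠ ρ₂ → Disjoint (supp ρ₁) (supp ρ₂)

/-- The three separation properties of an ensemble. -/
structure IsSeparated (G : SimpleGraph V) (α : ℝ) (N : Finset (V → ℤ)) : Prop where
  /-- There is at most one non-neutral density. -/
  charged_unique : ∀ ρ₁ ∈ N, ∀ ρ₂ ∈ N, charge ρ₁ ≠ 0 → charge ρ₂ ≠ 0 → ρ₁ = ρ₂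
  /-- Distinct densities are far from each other. -/
  far : ∀ ρ₁ ∈ N, ∀ ρ₂ ∈ N, ρ₁ ≠ ρ₂ →
    M * ((min (diam G ρ₁) (diam G ρ₂) : ℕ) : ℝ) ^ α ≤ (chargeDist G ρ₁ ρ₂ : ℝ)
  /-- All other densities are far from a non-neutral one, relative to their own diameter. -/
  far_charged : ∀ ρc ∈ N, charge ρc ≠ 0 → ∀ ρ ∈ N, ρ ≠ ρc →
    M * (diam G ρ : ℝ) ^ α ≤ (chargeDist G ρ ρc : ℝ)
  /-- A neutral density does not split into two far away neutral densities. -/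
  decomposition : ∀ ρ ∈ N, charge ρ = 0 → ∀ ρ₁ ρ₂ : V → ℤ, ρ₁ ≠ 0 → ρ₂ ≠ 0 →
    Disjoint (supp ρ₁) (supp ρ₂) → ρ = ρ₁ + ρ₂ →
    2 * M * ((min (diam G ρ₁) (diam G ρ₂) : ℕ) : ℝ) ^ α ≤ (chargeDist G ρ₁ ρ₂ : ℝ) →
    charge ρ₁ ≠ 0 ∧ charge ρ₂ ≠ 0

/-- The neutral densities of an ensemble. -/
def neutral (N : Finset (V → ℤ)) : Finset (V → ℤ) := {ρ ∈ N | charge ρ = 0}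

/-- The densities, other than `ρ`, of smaller diameter than `ρ` or of comparable diameter. -/
noncomputable def smaller (G : SimpleGraph V) (N₀ : Finset (V → ℤ)) (ρ : V → ℤ) :
    Finset (V → ℤ) :=
  {ρ' ∈ N₀ | diam G ρ' ≤ 2 * diam G ρ ∧ ρ ≠ ρ'}

open Classical in
/-- The squares of a scale `k` collection `S` that are separated from all other squares of `S`;
by convention there are none when `S` consists of a single square. -/
noncomputable def separatedSquares (G : SimpleGraph V) (α : ℝ) (k : ℕ) (S : Finset (Finset V)) :
    Finset (Finset V) :=
  if S.card = 1 then ∅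
  else {s ∈ S | ∀ s' ∈ S, s' ≠ s →
    2 * M * (2 : ℝ) ^ (α * ((k : ℝ) + 1)) ≤ (setDist G s' s : ℝ)}

end Graph

/-! ### Square coverings -/

/-- `S` is a collection of `2^k × 2^k` squares that covers the support of `ρ`. -/
def IsSquareCover (bc : BoundaryCondition) (L k : ℕ) (ρ : Fin L × Fin L → ℤ)
    (S : Finset (Finset (Fin L × Fin L))) : Prop :=
  (∀ s ∈ S, IsSquare bc L k s) ∧ ∀ j ∈ supp ρ, ∃ s ∈ S, j ∈ s

/-- `S` selects, for every density `ρ` and every scale `k`, a covering of the support of `ρ` by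
`2^k × 2^k` squares that has the least possible number of squares. -/
def IsMinimalCoverChoice (bc : BoundaryCondition) (L : ℕ)
    (S : ℕ → (Fin L × Fin L → ℤ) → Finset (Finset (Fin L × Fin L))) : Prop :=
  ∀ k, ∀ ρ : Fin L × Fin L → ℤ, ρ ≠ 0 →
    IsSquareCover bc L k ρ (S k ρ) ∧
      ∀ T, IsSquareCover bc L k ρ T → (S k ρ).card ≤ T.card

end SpinWave

/-
The wave `a` is a sum of waves whose gradients live on disjoint sets of edges, so that the energies
add. The first one is a multiple of `ρ` itself (of the indicator of the center, if `ρ` is a dipole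
of diameter `1`), and accounts for `‖ρ‖₂² / 16`. Each separated square of scale `k` cuts an island
out of `ρ`. By the decomposition property an island carries a nonzero charge, hence at least one
unit, while a linear cut-off at distances between `2 ^ k` and `2 ^ (k + 1)` from it has a Dirichlet
form bounded uniformly in `k`. So every island contributes a constant. Two cut-offs cannot vary
along the same edge: the distance from the edge to `ρ` determines the scale, and the point of `ρ`
nearest to it the island.

For the wave to be constant on the sets `D⁺(ρ')`, distances from an island are measured after
collapsing each of these sets to a point. That shortens distances from `ρ` by at most a factor of
`4`, as one sees by induction over the scales: the sets of radius about `4 ^ m` have mutual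
distances of order `8 ^ m = (4 ^ m) ^ (3 / 2)`, so that the steps between two visits to such sets
outweigh the diameters that are skipped, at the price of a factor `1 + O(2 ^ (-m))`.
-/

namespace SpinWave

section Chains

variable {V ι : Type*}

/-- `Chain G R x p n`: the vertex `p` can be reached from `x` by `n` steps along edges of `G` and
any number of free jumps along `R`. -/
inductive Chain (G : SimpleGraph V) (R : V → V → Prop) (x : V) : V → ℕ → Prop
  | refl : Chain G R x x 0
  | step {p q : V} {n : ℕ} : Chain G R x p n → G.Adj p q → Chain G R x q (n + 1)
  | jump {p q : V} {n : ℕ} : Chain G R x p n → R p q → Chain G R x q n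

lemma Chain.append_walk {G : SimpleGraph V} {R : V → V → Prop} {x p q : V} {n : ℕ}
    (h : Chain G R x p n) (w : G.Walk p q) : Chain G R x q (n + w.length) := by
  induction w generalizing n with
  | nil => exact h
  | cons e w ih =>
    rw [SimpleGraph.Walk.length_cons, Nat.add_comm w.length, ← Nat.add_assoc]
    exact ih (h.step e)

lemma Chain.dist_le {G : SimpleGraph V} {R : V → V → Prop} (hG : G.Connected)
    (hR : ∀ p q, ¬ R p q) {x p : V} {n : ℕ} (h : Chain G R x p n) : G.dist x p ≤ n := by
  induction h with
  | refl => exact SimpleGraph.dist_self.le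
  | step _ e ih =>
    exact hG.dist_triangle.trans
      (Nat.add_le_add ih (SimpleGraph.dist_eq_one_iff_adj.mpr e).le)
  | jump _ e => exact absurd e (hR _ _)

/-- Jumping along `Joined A s` collapses each of the sets `A i`, `i ∈ s`, to a point. -/
def Joined (A : ι → Set V) (s : Set ι) (p q : V) : Prop :=
  ∃ i ∈ s, p ∈ A i ∧ q ∈ A i

/-- Collapsing the sets `A i`, `i ∈ s`, shortens distances from the points of `B` by at most a
factor of `4`. -/
def BoundedDistortion (G : SimpleGraph V) (R : V → V → Prop) (B : Set V) : Prop :=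
  ∀ x ∈ B, ∀ p n, Chain G R x p n → G.dist x p ≤ 4 * n

/-- The indices of size below the scale `4 ^ m`. -/
def belowScale (d : ι → ℕ) (s : Set ι) (m : ℕ) : Set ι := {i ∈ s | d i < 4 ^ m}

/-- The sets `A i`, `i ∈ s`, have centers `c i` and radii at most `2 * d i`, and two of them of
size at least `4 ^ m` are separated by a large multiple of `(4 ^ m) ^ (3 / 2) = 8 ^ m`. -/
structure IsSparse (G : SimpleGraph V) (A : ι → Set V) (c : ι → V) (d : ι → ℕ) (s : Set ι) :
    Prop where
  dist_center : ∀ i ∈ s, ∀ z ∈ A i, G.dist z (c i) ≤ 2 * d i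
  center_mem : ∀ i ∈ s, c i ∈ A i
  one_le : ∀ i ∈ s, 1 ≤ d i
  separated : ∀ i ∈ s, ∀ j ∈ s, i ≠ j → ∀ m, 4 ^ m ≤ d i → 4 ^ m ≤ d j →
    16384 * 8 ^ m ≤ G.dist (c i) (c j)

/-- A chain of length `n` from `x` to `p` whose last jump at scale `m` is made inside `A i`: it
reaches `A i` after `n₀` steps and takes only smaller jumps afterwards. -/
def LastVisit (G : SimpleGraph V) (A : ι → Set V) (d : ι → ℕ) (s : Set ι) (m : ℕ) (x p : V)
    (n : ℕ) (i : ι) : Prop :=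
  i ∈ s ∧ 4 ^ m ≤ d i ∧ d i < 4 ^ (m + 1) ∧ ∃ y ∈ A i, ∃ n₀ n₁, n₀ + n₁ = n ∧
    Chain G (Joined A (belowScale d s m)) y p n₁ ∧
    ∀ z ∈ A i, (G.dist x z : ℝ) ≤ (2 - (1 / 2) ^ (m + 1)) * n₀ + 24 * 4 ^ m

variable {G : SimpleGraph V} {A : ι → Set V} {c : ι → V} {d : ι → ℕ} {s : Set ι}

lemma dist_triangle_real (hG : G.Connected) (x y z : V) :
    (G.dist x z : ℝ) ≤ G.dist x y + G.dist y z := by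
  exact_mod_cast hG.dist_triangle

lemma IsSparse.dist_center_le (h : IsSparse G A c d s) {i : ι} (hi : i ∈ s) {m : ℕ}
    (hd : d i < 4 ^ (m + 1)) {z : V} (hz : z ∈ A i) : G.dist z (c i) ≤ 8 * 4 ^ m := by
  have := h.dist_center i hi z hz
  rw [pow_succ] at hd
  lia

lemma IsSparse.dist_le (h : IsSparse G A c d s) (hG : G.Connected) {i : ι} (hi : i ∈ s) {m : ℕ}
    (hd : d i < 4 ^ (m + 1)) {y z : V} (hy : y ∈ A i) (hz : z ∈ A i) :
    G.dist y z ≤ 16 * 4 ^ m := by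
  have hyc := h.dist_center_le hi hd hy
  have hzc := h.dist_center_le hi hd hz
  have htri := hG.dist_triangle (u := y) (v := c i) (w := z)
  rw [SimpleGraph.dist_comm (u := z)] at hzc
  lia

lemma four_pow_le_eight_pow (m : ℕ) : (4 : ℝ) ^ m ≤ 8 ^ m :=
  pow_le_pow_left₀ (by norm_num) (by norm_num) m

lemma half_pow_mul_eight_pow (m : ℕ) : (1 / 2 : ℝ) ^ m * 8 ^ m = 4 ^ m := by
  rw [← mul_pow]
  norm_num

lemma IsSparse.le_dist (h : IsSparse G A c d s) (hG : G.Connected) {i j : ι} (hi : i ∈ s)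
    (hj : j ∈ s) (hij : i ≠ j) {m : ℕ} (him : 4 ^ m ≤ d i) (him' : d i < 4 ^ (m + 1))
    (hjm : 4 ^ m ≤ d j) (hjm' : d j < 4 ^ (m + 1)) {y z : V} (hy : y ∈ A i) (hz : z ∈ A j) :
    16368 * 8 ^ m ≤ G.dist y z := by
  have hsep := h.separated i hi j hj hij m him hjm
  have hyc := h.dist_center_le hi him' hy
  have hzc := h.dist_center_le hj hjm' hz
  have htri₁ := hG.dist_triangle (u := c i) (v := y) (w := c j)
  have htri₂ := hG.dist_triangle (u := y) (v := z) (w := c j)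
  have hpow : 4 ^ m ≤ 8 ^ m := Nat.pow_le_pow_left (by norm_num) m
  rw [SimpleGraph.dist_comm] at hyc
  lia

/-- The claim at scale `m` of the induction over scales: jumps below scale `m` shorten distances
by at most a factor `2 - (1 / 2) ^ m`, up to an error of order `4 ^ m`. -/
def DistortionBound (G : SimpleGraph V) (A : ι → Set V) (d : ι → ℕ) (s : Set ι) (m : ℕ) : Prop :=
  ∀ x p n, Chain G (Joined A (belowScale d s m)) x p n →
    (G.dist x p : ℝ) ≤ (2 - (1 / 2) ^ m) * n + 8 * 4 ^ m

/-- Arriving at `A j` by a jump of scale `m` from elsewhere: the steps made since the last visit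
to some other set of that scale pay for the two diameters. -/
lemma LastVisit.jump (hG : G.Connected) (h : IsSparse G A c d s) {m : ℕ}
    (hm : DistortionBound G A d s m) {x p q : V} {n : ℕ} {i j : ι}
    (hv : LastVisit G A d s m x p n i) (hj : j ∈ s) (hjm : 4 ^ m ≤ d j)
    (hjm' : d j < 4 ^ (m + 1)) (hp : p ∈ A j) (hq : q ∈ A j) :
    LastVisit G A d s m x q n j := by
  obtain ⟨hi, him, him', y, hy, n₀, n₁, rfl, hyp, hx⟩ := hv
  refine ⟨hj, hjm, hjm', q, hq, n₀ + n₁, 0, rfl, .refl, fun z hz => ?_⟩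
  have hhalf : (1 / 2 : ℝ) ^ (m + 1) = (1 / 2) ^ m / 2 := by rw [pow_succ]; ring
  have hhalf_le : (1 / 2 : ℝ) ^ m ≤ 1 := pow_le_one₀ (by norm_num) (by norm_num)
  push_cast
  by_cases hij : i = j
  · subst hij
    have : 0 ≤ (2 - (1 / 2 : ℝ) ^ (m + 1)) * n₁ :=
      mul_nonneg (by linarith) (Nat.cast_nonneg n₁)
    linarith [hx z hz]
  · have hgap : (16368 * 8 ^ m : ℝ) ≤ G.dist y p := by
      exact_mod_cast h.le_dist hG hi hj hij him him' hjm hjm' hy hp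
    have hyp' := hm y p n₁ hyp
    have hpz : (G.dist p z : ℝ) ≤ 16 * 4 ^ m := by exact_mod_cast h.dist_le hG hj hjm' hp hz
    have hn₁ : 48 * 8 ^ m ≤ (n₁ : ℝ) := by
      have : 0 ≤ (1 / 2 : ℝ) ^ m * n₁ := by positivity
      linarith [four_pow_le_eight_pow m]
    have hpay : 48 * 4 ^ m ≤ (1 / 2 : ℝ) ^ m * n₁ :=
      calc (48 : ℝ) * 4 ^ m = (1 / 2) ^ m * (48 * 8 ^ m) := by
            rw [← half_pow_mul_eight_pow]; ring
        _ ≤ (1 / 2) ^ m * n₁ := by gcongr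
    have hxy := hx y hy
    rw [hhalf] at hxy ⊢
    linarith [dist_triangle_real hG x y z, dist_triangle_real hG y p z]

lemma Chain.below_or_lastVisit (hG : G.Connected) (h : IsSparse G A c d s) {m : ℕ}
    (hm : DistortionBound G A d s m) {x p : V} {n : ℕ}
    (hc : Chain G (Joined A (belowScale d s (m + 1))) x p n) :
    Chain G (Joined A (belowScale d s m)) x p n ∨ ∃ i, LastVisit G A d s m x p n i := by
  induction hc with
  | refl => exact .inl .refl
  | step _ e ih =>
    rcases ih with ih | ⟨i, hi, him, him', y, hy, n₀, n₁, rfl, hyp, hx⟩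
    · exact .inl (ih.step e)
    · exact .inr ⟨i, hi, him, him', y, hy, n₀, n₁ + 1, rfl, hyp.step e, hx⟩
  | @jump p q n _ e ih =>
    obtain ⟨j, ⟨hj, hjm'⟩, hp, hq⟩ := e
    by_cases hjm : d j < 4 ^ m
    · have e : Joined A (belowScale d s m) p q := ⟨j, ⟨hj, hjm⟩, hp, hq⟩
      rcases ih with ih | ⟨i, hi, him, him', y, hy, n₀, n₁, rfl, hyp, hx⟩
      · exact .inl (ih.jump e)
      · exact .inr ⟨i, hi, him, him', y, hy, n₀, n₁, rfl, hyp.jump e, hx⟩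
    · rw [not_lt] at hjm
      refine .inr ⟨j, ?_⟩
      rcases ih with ih | ⟨i, hv⟩
      · refine ⟨hj, hjm, hjm', q, hq, n, 0, rfl, .refl, fun z hz => ?_⟩
        have hpz : (G.dist p z : ℝ) ≤ 16 * 4 ^ m := by
          exact_mod_cast h.dist_le hG hj hjm' hp hz
        have hcoef : (2 - (1 / 2 : ℝ) ^ m) * n ≤ (2 - (1 / 2) ^ (m + 1)) * n := by
          gcongr (2 - ?_) * _
          exact pow_le_pow_of_le_one (by norm_num) (by norm_num) m.le_succ
        linarith [hm x p n ih, dist_triangle_real hG x p z]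
      · exact hv.jump hG h hm hj hjm hjm' hp hq

lemma IsSparse.not_joined_belowScale_zero (h : IsSparse G A c d s) (p q : V) :
    ¬ Joined A (belowScale d s 0) p q :=
  fun ⟨i, ⟨hi, hd⟩, _⟩ => absurd (h.one_le i hi) (by simpa using hd)

lemma IsSparse.distortionBound (hG : G.Connected) (h : IsSparse G A c d s) (m : ℕ) :
    DistortionBound G A d s m := by
  induction m with
  | zero =>
    intro x p n hc
    have : (G.dist x p : ℝ) ≤ n := by exact_mod_cast hc.dist_le hG h.not_joined_belowScale_zero
    norm_num
    linarith
  | succ m ih =>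
    intro x p n hc
    have hcoef : (2 - (1 / 2 : ℝ) ^ m) ≤ (2 - (1 / 2) ^ (m + 1)) :=
      sub_le_sub_left (pow_le_pow_of_le_one (by norm_num) (by norm_num) m.le_succ) _
    have hpow : (4 : ℝ) ^ (m + 1) = 4 * 4 ^ m := pow_succ' 4 m
    have hpos : (0 : ℝ) < 4 ^ m := by positivity
    rcases hc.below_or_lastVisit hG h ih with hc | ⟨i, -, -, -, y, hy, n₀, n₁, rfl, hyp, hx⟩
    · have := mul_le_mul_of_nonneg_right hcoef (Nat.cast_nonneg n)
      linarith [ih x p n hc]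
    · have := mul_le_mul_of_nonneg_right hcoef (Nat.cast_nonneg n₁)
      push_cast
      linarith [ih y p n₁ hyp, hx y hy, dist_triangle_real hG x y p]

lemma IsSparse.dist_le_four_mul (hG : G.Connected) (h : IsSparse G A c d s) {x : V}
    (hx : ∀ i ∈ s, ∀ m, 4 ^ m ≤ d i → 16384 * 8 ^ m ≤ G.dist x (c i)) (m : ℕ) {p : V} {n : ℕ}
    (hc : Chain G (Joined A (belowScale d s m)) x p n) : G.dist x p ≤ 4 * n := by
  induction m with
  | zero => exact (hc.dist_le hG h.not_joined_belowScale_zero).trans (by lia)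
  | succ m ih =>
    have hm := h.distortionBound hG m
    rcases hc.below_or_lastVisit hG h hm with hc | ⟨i, hi, him, -, y, hy, n₀, n₁, rfl, hyp, hxA⟩
    · exact ih hc
    · have hfar : (16384 * 8 ^ m : ℝ) ≤ G.dist x (c i) := by exact_mod_cast hx i hi m him
      have hxc := hxA _ (h.center_mem i hi)
      have hn₀ : 0 ≤ (1 / 2 : ℝ) ^ (m + 1) * n₀ := by positivity
      have hn₁ : 0 ≤ (1 / 2 : ℝ) ^ m * n₁ := by positivity
      have : (G.dist x p : ℝ) ≤ 4 * (n₀ + n₁) := by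
        linarith [hxA y hy, hm y p n₁ hyp, dist_triangle_real hG x y p, four_pow_le_eight_pow m]
      exact_mod_cast this

lemma IsSparse.boundedDistortion (hG : G.Connected) (h : IsSparse G A c d s) (hs : s.Finite)
    {B : Set V} (hB : ∀ x ∈ B, ∀ i ∈ s, ∀ m, 4 ^ m ≤ d i → 16384 * 8 ^ m ≤ G.dist x (c i)) :
    BoundedDistortion G (Joined A s) B := by
  obtain ⟨m, hm⟩ : ∃ m, belowScale d s m = s := by
    obtain ⟨K, hK⟩ := (hs.image d).bddAbove
    exact ⟨K, Set.sep_eq_self_iff_mem_true.mpr fun i hi =>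
      (hK (Set.mem_image_of_mem d hi)).trans_lt (Nat.lt_pow_self (by norm_num))⟩
  intro x hx p n hc
  rw [← hm] at hc
  exact h.dist_le_four_mul hG (hB x hx) m hc

end Chains

section Geometry

open SimpleGraph
open scoped Fin.CommRing

lemma cliqueFree_three_boxProd {V W : Type*} {G : SimpleGraph V} {H : SimpleGraph W}
    (hG : G.CliqueFree 3) (hH : H.CliqueFree 3) : (G □ H).CliqueFree 3 := by
  classical
  intro t ht
  obtain ⟨⟨a, a'⟩, ⟨b, b'⟩, ⟨c, c'⟩, hab, hac, hbc, -⟩ := is3Clique_iff.mp ht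
  simp only [boxProd_adj] at hab hac hbc
  have hG' : G.Adj a b → G.Adj a c → ¬ G.Adj b c := fun h₁ h₂ h₃ =>
    hG _ (is3Clique_iff.mpr ⟨a, b, c, h₁, h₂, h₃, rfl⟩)
  have hH' : H.Adj a' b' → H.Adj a' c' → ¬ H.Adj b' c' := fun h₁ h₂ h₃ =>
    hH _ (is3Clique_iff.mpr ⟨a', b', c', h₁, h₂, h₃, rfl⟩)
  have hGne : ∀ {u v}, G.Adj u v → u ≠ v := fun h => h.ne
  have hHne : ∀ {u v}, H.Adj u v → u ≠ v := fun h => h.ne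
  grind

lemma dist_boxProd {V W : Type*} {G : SimpleGraph V} {H : SimpleGraph W} (hG : G.Connected)
    (hH : H.Connected) (x y : V × W) : (G □ H).dist x y = G.dist x.1 y.1 + H.dist x.2 y.2 := by
  rw [SimpleGraph.dist, edist_boxProd, ENat.toNat_add]
  · rfl
  · exact edist_ne_top_iff_reachable.mpr (hG.preconnected _ _)
  · exact edist_ne_top_iff_reachable.mpr (hH.preconnected _ _)

lemma ncard_ball_boxProd_le {V W : Type*} [Finite V] [Finite W] {G : SimpleGraph V}
    {H : SimpleGraph W} (hG : G.Connected) (hH : H.Connected) (x : V × W) (r : ℕ) :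
    {y | (G □ H).dist x y ≤ r}.ncard ≤
      {v | G.dist x.1 v ≤ r}.ncard * {w | H.dist x.2 w ≤ r}.ncard := by
  rw [← Set.ncard_prod]
  refine Set.ncard_le_ncard fun y hy => ?_
  rw [Set.mem_ofPred_eq, dist_boxProd hG hH] at hy
  exact ⟨le_of_add_le_left hy, le_of_add_le_right hy⟩

lemma dist_le_of_forall_adj_or_eq {V : Type*} {G : SimpleGraph V} (hG : G.Connected)
    (f : ℕ → V) (m : ℕ) (hf : ∀ k < m, G.Adj (f k) (f (k + 1)) ∨ f k = f (k + 1)) :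
    G.dist (f 0) (f m) ≤ m := by
  induction m with
  | zero => exact dist_self.le
  | succ m ih =>
    refine hG.dist_triangle.trans (Nat.add_le_add (ih fun k hk => ?_) ?_)
    · exact hf k (hk.trans m.lt_succ_self)
    rcases hf m m.lt_succ_self with h | h
    · exact (dist_eq_one_iff_adj.mpr h).le
    · simp [h]

/-- The one-dimensional factor of the square domain. -/
def line (bc : BoundaryCondition) (L : ℕ) : SimpleGraph (Fin L) :=
  match bc with
  | .free => pathGraph L
  | .periodic => cycleGraph L

variable {bc : BoundaryCondition} {L : ℕ}

lemma squareDomain_eq (bc : BoundaryCondition) (L : ℕ) :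
    squareDomain bc L = line bc L □ line bc L := by
  cases bc <;> rfl

/-- A coordinate `q` lies among the `w` consecutive sites starting at `p`. -/
def InWindow (bc : BoundaryCondition) (L w : ℕ) (p q : Fin L) : Prop :=
  match bc with
  | .free => p.val ≤ q.val ∧ q.val < p.val + w
  | .periodic => ((q.val : ℤ) - (p.val : ℤ)) % (L : ℤ) < (w : ℤ)

lemma mem_box {w : ℕ} {p q : Fin L × Fin L} :
    q ∈ box bc L w p ↔ InWindow bc L w p.1 q.1 ∧ InWindow bc L w p.2 q.2 := by
  cases bc <;> simp [box, InWindow]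

variable [NeZero L]

lemma cycleGraph_adj_iff {u v : Fin L} :
    (cycleGraph L).Adj u v ↔ u ≠ v ∧ (v = u + 1 ∨ v = u - 1) := by
  obtain _ | _ | n := L
  · exact u.elim0
  · simp [Fin.fin_one_eq_zero u, Fin.fin_one_eq_zero v]
  · rw [cycleGraph_adj, sub_eq_iff_eq_add', sub_eq_iff_eq_add', or_comm, eq_sub_iff_add_eq,
      eq_comm (a := u)]
    refine ⟨fun h => ⟨?_, h⟩, And.right⟩
    rintro rfl
    simp at h

lemma line_connected (bc : BoundaryCondition) : (line bc L).Connected := by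
  obtain ⟨n, rfl⟩ := Nat.exists_eq_succ_of_ne_zero (NeZero.ne L)
  cases bc
  · exact pathGraph_connected n
  · exact cycleGraph_connected

lemma squareDomain_connected (bc : BoundaryCondition) : (squareDomain bc L).Connected := by
  rw [squareDomain_eq]
  exact (line_connected bc).boxProd (line_connected bc)

lemma line_adj {u v : Fin L} (h : (line bc L).Adj u v) : v = u + 1 ∨ v = u - 1 := by
  have h' : (cycleGraph L).Adj u v := by
    cases bc
    · exact pathGraph_le_cycleGraph h
    · exact h
  exact (cycleGraph_adj_iff.mp h').2

lemma line_cliqueFree_three (h3 : bc = .periodic → L ≠ 3) : (line bc L).CliqueFree 3 := by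
  cases bc
  · exact cliqueFree_hasse_three
  · classical
    intro t ht
    obtain ⟨u, v, w, huv, huw, hvw, -⟩ := is3Clique_iff.mp ht
    rw [line, cycleGraph_adj_iff] at huv huw hvw
    have h : (3 : Fin L) = 0 := by grind
    have h' : L ∣ 3 := Fin.natCast_eq_zero.mp h
    rcases (Nat.dvd_prime Nat.prime_three).mp h' with rfl | rfl
    · exact huv.1 (Subsingleton.elim u v)
    · exact h3 rfl rfl

lemma line_natCast_adj_or_eq {m : ℕ} (hm : bc = .free → m + 1 < L) :
    (line bc L).Adj (m : Fin L) ((m + 1 : ℕ) : Fin L) ∨ (m : Fin L) = ((m + 1 : ℕ) : Fin L) := by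
  cases bc
  · have := hm rfl
    refine .inl (pathGraph_adj.mpr (.inl ?_))
    rw [Fin.val_natCast, Fin.val_natCast, Nat.mod_eq_of_lt this, Nat.mod_eq_of_lt (by lia)]
  · rw [line, cycleGraph_adj_iff]
    by_cases h : (m : Fin L) = ((m + 1 : ℕ) : Fin L)
    · exact .inr h
    · exact .inl ⟨h, .inl (Nat.cast_succ m)⟩

lemma dist_line_natCast_le {a m : ℕ} (h : bc = .free → a + m < L) :
    (line bc L).dist (a : Fin L) ((a + m : ℕ) : Fin L) ≤ m :=
  dist_le_of_forall_adj_or_eq (line_connected bc) (fun k => ((a + k : ℕ) : Fin L)) m fun _ hk =>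
    line_natCast_adj_or_eq fun hbc => by have := h hbc; lia

lemma InWindow.exists_offset {w : ℕ} {p q : Fin L} (h : InWindow bc L w p q) :
    ∃ r < w, ((p.val + r : ℕ) : Fin L) = q ∧ (bc = .free → p.val + r < L) := by
  cases bc
  · refine ⟨q.val - p.val, by have := h.1; have := h.2; lia, ?_, fun _ => ?_⟩
    · rw [Nat.add_sub_cancel' h.1, Fin.cast_val_eq_self]
    · rw [Nat.add_sub_cancel' h.1]
      exact q.isLt
  · have hL : (L : ℤ) ≠ 0 := by exact_mod_cast NeZero.ne L
    obtain ⟨r, hr⟩ := Int.eq_ofNat_of_zero_le (Int.emod_nonneg ((q.val : ℤ) - p.val) hL)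
    refine ⟨r, ?_, ?_, nofun⟩
    · rw [InWindow, hr] at h
      exact_mod_cast h
    · have : ((p.val + r : ℕ) : ℤ) % L = q.val := by
        rw [Nat.cast_add, ← hr, Int.add_emod_emod, add_sub_cancel]
        exact_mod_cast Nat.mod_eq_of_lt q.isLt
      exact Fin.ext (by rw [Fin.val_natCast]; exact_mod_cast this)

lemma InWindow.dist_le {w : ℕ} {p q q' : Fin L} (h : InWindow bc L w p q)
    (h' : InWindow bc L w p q') : (line bc L).dist q q' ≤ w := by
  obtain ⟨r, hr, rfl, hrL⟩ := h.exists_offset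
  obtain ⟨r', hr', rfl, hrL'⟩ := h'.exists_offset
  wlog hle : r ≤ r' generalizing r r'
  · rw [dist_comm]
    exact this r' hr' hrL' h' r hr hrL h (le_of_not_ge hle)
  obtain ⟨m, rfl⟩ := Nat.exists_eq_add_of_le hle
  rw [← Nat.add_assoc]
  exact (dist_line_natCast_le fun hbc => by have := hrL' hbc; lia).trans (by lia)

lemma dist_le_of_isSquare {k : ℕ} {s : Finset (Fin L × Fin L)} (hs : IsSquare bc L k s)
    {q q' : Fin L × Fin L} (hq : q ∈ s) (hq' : q' ∈ s) :
    (squareDomain bc L).dist q q' ≤ 2 ^ (k + 1) := by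
  obtain ⟨⟨p, rfl⟩, -⟩ := hs
  rw [mem_box] at hq hq'
  rw [squareDomain_eq, dist_boxProd (line_connected bc) (line_connected bc), pow_succ, mul_two]
  exact Nat.add_le_add (hq.1.dist_le hq'.1) (hq.2.dist_le hq'.2)

lemma exists_displacement_of_walk {u v : Fin L} (w : (line bc L).Walk u v) :
    ∃ a : ℤ, |a| ≤ w.length ∧ v = u + a := by
  induction w with
  | nil => exact ⟨0, by simp, by simp⟩
  | cons e w ih =>
    obtain ⟨a, ha, rfl⟩ := ih
    rw [Walk.length_cons]
    rw [abs_le] at ha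
    rcases line_adj e with rfl | rfl
    · exact ⟨a + 1, by rw [abs_le]; lia, by push_cast; abel⟩
    · exact ⟨a - 1, by rw [abs_le]; lia, by push_cast; abel⟩

lemma ncard_ball_line_le (u : Fin L) (r : ℕ) :
    {v | (line bc L).dist u v ≤ r}.ncard ≤ 2 * r + 1 := by
  have hsub : {v | (line bc L).dist u v ≤ r} ⊆
      ((Finset.Icc (-(r : ℤ)) r).image fun a : ℤ => u + (a : Fin L) : Finset (Fin L)) := by
    intro v hv
    obtain ⟨w, hw⟩ := (line_connected bc).exists_walk_length_eq_dist u v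
    obtain ⟨a, ha, rfl⟩ := exists_displacement_of_walk w
    rw [Set.mem_ofPred_eq] at hv
    rw [hw, abs_le] at ha
    simp only [Finset.coe_image, Set.mem_image, Finset.mem_coe, Finset.mem_Icc]
    exact ⟨a, by lia, rfl⟩
  calc _ ≤ _ := Set.ncard_le_ncard hsub
    _ ≤ (Finset.Icc (-(r : ℤ)) r).card := by
      rw [Set.ncard_coe_finset]
      exact Finset.card_image_le
    _ = 2 * r + 1 := by rw [Int.card_Icc]; lia

lemma ncard_ball_squareDomain_le (x : Fin L × Fin L) (r : ℕ) :
    {y | (squareDomain bc L).dist x y ≤ r}.ncard ≤ (2 * r + 1) ^ 2 := by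
  rw [squareDomain_eq, sq]
  exact (ncard_ball_boxProd_le (line_connected bc) (line_connected bc) x r).trans
    (Nat.mul_le_mul (ncard_ball_line_le _ _) (ncard_ball_line_le _ _))

lemma ncard_neighborSet_squareDomain_le (u : Fin L × Fin L) :
    ((squareDomain bc L).neighborSet u).ncard ≤ 4 := by
  have hsub : (squareDomain bc L).neighborSet u ⊆
      ({(u.1 + 1, u.2), (u.1 - 1, u.2), (u.1, u.2 + 1), (u.1, u.2 - 1)} :
        Finset (Fin L × Fin L)) := by
    rintro ⟨v₁, v₂⟩ h
    rw [squareDomain_eq, mem_neighborSet, boxProd_adj] at h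
    rcases h with ⟨e, rfl⟩ | ⟨e, rfl⟩ <;> rcases line_adj e with rfl | rfl <;> simp
  refine (Set.ncard_le_ncard hsub).trans ?_
  rw [Set.ncard_coe_finset]
  exact Finset.card_le_four

lemma squareDomain_cliqueFree_three (h3 : bc = .periodic → L ≠ 3) :
    (squareDomain bc L).CliqueFree 3 := by
  rw [squareDomain_eq]
  exact cliqueFree_three_boxProd (line_cliqueFree_three h3) (line_cliqueFree_three h3)

end Geometry

section Densities

variable {V : Type*} [Fintype V] {G : SimpleGraph V} {ρ : V → ℤ}

lemma mem_supp {p : V} : p ∈ supp ρ ↔ ρ p ≠ 0 := by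
  simp [supp]

lemma norm₂_sq (ρ : V → ℤ) : norm₂ ρ ^ 2 = ∑ p, (ρ p : ℝ) ^ 2 :=
  Real.sq_sqrt (Finset.sum_nonneg fun _ _ => sq_nonneg _)

lemma dist_le_diam {x y : V} (hx : x ∈ supp ρ) (hy : y ∈ supp ρ) : G.dist x y ≤ diam G ρ :=
  Finset.le_sup (f := fun p : V × V => G.dist p.1 p.2) (Finset.mk_mem_product hx hy)

lemma exists_ne_mem_supp (hQ : charge ρ = 0) {c : V} (hc : c ∈ supp ρ) :
    ∃ c' ∈ supp ρ, c' ≠ c := by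
  by_contra! h
  refine mem_supp.mp hc ?_
  rw [← hQ, charge, Fintype.sum_eq_single c]
  exact fun p hp => not_not.mp fun h0 => hp (h p (mem_supp.mpr h0))

lemma one_le_diam (hG : G.Connected) (hQ : charge ρ = 0) {c : V} (hc : c ∈ supp ρ) :
    1 ≤ diam G ρ := by
  obtain ⟨c', hc', hne⟩ := exists_ne_mem_supp hQ hc
  exact (hG.pos_dist_of_ne hne).trans_le (dist_le_diam hc' hc)

lemma norm₂_sq_of_diam_le_one (hG : G.Connected) (hG3 : G.CliqueFree 3) (hQ : charge ρ = 0)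
    {c : V} (hc : c ∈ supp ρ) (hd : diam G ρ ≤ 1) : norm₂ ρ ^ 2 = 2 * (ρ c : ℝ) ^ 2 := by
  classical
  obtain ⟨c', hc', hne⟩ := exists_ne_mem_supp hQ hc
  have hadj : ∀ x ∈ supp ρ, ∀ y ∈ supp ρ, x ≠ y → G.Adj x y := fun x hx y hy hxy =>
    SimpleGraph.dist_eq_one_iff_adj.mp
      (((dist_le_diam hx hy).trans hd).antisymm (hG.pos_dist_of_ne hxy))
  have hpair : ∀ p, p ≠ c ∧ p ≠ c' → ρ p = 0 := by
    rintro p ⟨hpc, hpc'⟩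
    by_contra hp
    have hp := mem_supp.mpr hp
    exact hG3 {c, c', p} (SimpleGraph.is3Clique_triple_iff.mpr
      ⟨hadj c hc c' hc' hne.symm, hadj c hc p hp hpc.symm, hadj c' hc' p hp hpc'.symm⟩)
  have hsum : ρ c + ρ c' = 0 := by
    rw [← hQ, charge, Fintype.sum_eq_add c c' hne.symm hpair]
  rw [norm₂_sq, Fintype.sum_eq_add c c' hne.symm fun p hp => by simp [hpair p hp],
    eq_neg_of_add_eq_zero_right hsum]
  push_cast
  ring

end Densities

section Energy

variable {V : Type*} [Fintype V] {G : SimpleGraph V} {ρ : V → ℤ} {β : ℝ}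

lemma dirichlet_le_of_sq_sub_le {r : ℕ} (hr : ∀ u, (G.neighborSet u).ncard ≤ r) {f w : V → ℝ}
    (hw : ∀ p, 0 ≤ w p) (h : ∀ p q, G.Adj p q → (f p - f q) ^ 2 ≤ w p + w q) :
    dirichlet G f ≤ r * ∑ p, w p := by
  classical
  have hsum : ∑ p, ∑ q, (if G.Adj p q then w p else 0) ≤ r * ∑ p, w p := by
    rw [Finset.mul_sum]
    refine Finset.sum_le_sum fun p _ => ?_
    rw [← Finset.sum_filter, Finset.sum_const, nsmul_eq_mul]
    have : (Finset.univ.filter (G.Adj p)).card ≤ r := by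
      rw [← Set.ncard_coe_finset]
      simpa [SimpleGraph.neighborSet] using hr p
    have := hw p
    gcongr
  have hcomm : ∑ p, ∑ q, (if G.Adj p q then w q else 0) =
      ∑ p, ∑ q, (if G.Adj p q then w p else 0) := by
    rw [Finset.sum_comm]
    simp only [G.adj_comm]
  rw [dirichlet, div_le_iff₀ two_pos]
  calc _ ≤ ∑ p, ∑ q, ((if G.Adj p q then w p else 0) + if G.Adj p q then w q else 0) := by
        gcongr with p _ q _
        split_ifs with e
        · exact h p q e
        · simp
    _ ≤ _ := by
        simp only [Finset.sum_add_distrib, hcomm]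
        linarith

lemma dirichlet_smul (t : ℝ) (f : V → ℝ) : dirichlet G (t • f) = t ^ 2 * dirichlet G f := by
  simp only [dirichlet, Pi.smul_apply, smul_eq_mul, ← mul_sub, mul_pow, ← mul_ite_zero,
    ← Finset.mul_sum, mul_div_assoc]

/-- The multiple `t = ⟨f, ρ⟩ / (β K)` maximizes `t ⟨f, ρ⟩ - β / 2 * t ^ 2 * K`. -/
lemma le_energy_smul {f : V → ℝ} {K s : ℝ} (hβ : 0 < β) (hK : 0 < K) (hf : dirichlet G f ≤ K)
    (hs : ∑ p, f p * (ρ p : ℝ) = s) :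
    1 / β * (s ^ 2 / (2 * K)) ≤ energy G β ((s / (β * K)) • f) ρ := by
  have hlin : ∑ p, ((s / (β * K)) • f) p * (ρ p : ℝ) = s / (β * K) * s := by
    simp only [Pi.smul_apply, smul_eq_mul, mul_assoc, ← Finset.mul_sum, hs]
  rw [energy, hlin, dirichlet_smul]
  calc 1 / β * (s ^ 2 / (2 * K)) = s / (β * K) * s - β / 2 * ((s / (β * K)) ^ 2 * K) := by
        field_simp
        ring
    _ ≤ _ := by gcongr

lemma energy_add {f g : V → ℝ} (h : ∀ p q, G.Adj p q → f p = f q ∨ g p = g q) :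
    energy G β (f + g) ρ = energy G β f ρ + energy G β g ρ := by
  classical
  have hdir : dirichlet G (f + g) = dirichlet G f + dirichlet G g := by
    simp only [dirichlet, ← add_div, ← Finset.sum_add_distrib]
    congr! 3 with p _ q _
    split_ifs with e
    · rcases h p q e with h | h <;> simp only [Pi.add_apply, h] <;> ring
    · simp
  simp only [energy, hdir, Pi.add_apply, add_mul, Finset.sum_add_distrib]
  ring

lemma energy_sum {ι : Type*} (T : Finset ι) (f : ι → V → ℝ)
    (h : ∀ i ∈ T, ∀ j ∈ T, i ≠ j → ∀ p q, G.Adj p q → f i p = f i q ∨ f j p = f j q) :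
    energy G β (∑ i ∈ T, f i) ρ = ∑ i ∈ T, energy G β (f i) ρ := by
  classical
  induction T using Finset.induction_on with
  | empty => simp [energy, dirichlet]
  | insert i T hi ih =>
    rw [Finset.sum_insert hi, Finset.sum_insert hi, energy_add, ih]
    · exact fun j hj l hl => h j (Finset.mem_insert_of_mem hj) l (Finset.mem_insert_of_mem hl)
    · intro p q e
      refine or_iff_not_imp_left.mpr fun hne => ?_
      simp only [Finset.sum_apply]
      refine Finset.sum_congr rfl fun j hj => ?_
      have hij : i ≠ j := fun hij => hi (hij ▸ hj)
      exact (h i (Finset.mem_insert_self i T) j (Finset.mem_insert_of_mem hj) hij p q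
        e).resolve_left hne

end Energy

section BaseWave

variable {V : Type*} [Fintype V] {G : SimpleGraph V} {ρ : V → ℤ} {β : ℝ}

lemma dirichlet_single_le [DecidableEq V] {r : ℕ} (hr : ∀ u, (G.neighborSet u).ncard ≤ r)
    (c : V) : dirichlet G (Pi.single c 1) ≤ r := by
  refine (dirichlet_le_of_sq_sub_le (w := Pi.single c 1) hr (fun p => ?_) fun p q e => ?_).trans
    (by simp)
  · exact (Pi.single_nonneg.mpr zero_le_one : (0 : V → ℝ) ≤ Pi.single c 1) p
  · by_cases hp : p = c <;> by_cases hq : q = c <;> simp_all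

lemma dirichlet_cast_le {r : ℕ} (hr : ∀ u, (G.neighborSet u).ncard ≤ r) (ρ : V → ℤ) :
    dirichlet G (fun p => (ρ p : ℝ)) ≤ 2 * r * norm₂ ρ ^ 2 := by
  refine (dirichlet_le_of_sq_sub_le (w := fun p => 2 * (ρ p : ℝ) ^ 2) hr
    (fun _ => by positivity) fun p q _ => ?_).trans ?_
  · linarith [sq_nonneg ((ρ p : ℝ) + ρ q)]
  · rw [norm₂_sq, ← Finset.mul_sum]
    exact le_of_eq (by ring)

lemma exists_baseWave (hG : G.Connected) (hG3 : G.CliqueFree 3)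
    (hdeg : ∀ u, (G.neighborSet u).ncard ≤ 4) (hβ : 0 < β) (hQ : charge ρ = 0) {c : V}
    (hc : c ∈ supp ρ) :
    ∃ a : V → ℝ, (∀ p, a p ≠ 0 → p ∈ supp ρ ∧ G.dist p c + 2 ≤ 2 * diam G ρ) ∧
      1 / β * (1 / 16 * norm₂ ρ ^ 2) ≤ energy G β a ρ := by
  classical
  have hρc : (0 : ℝ) < (ρ c : ℝ) ^ 2 := by
    have := mem_supp.mp hc
    positivity
  rcases (one_le_diam hG hQ hc).eq_or_lt with hd | hd
  -- A wave on both ends of a dipole of diameter `1` would not keep the required distance.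
  · refine ⟨_, fun p hp => ?_, le_trans (le_of_eq ?_)
      (le_energy_smul hβ four_pos (dirichlet_single_le hdeg c) (s := ρ c)
        (by simp [Pi.single_apply]))⟩
    · obtain rfl : p = c := by
        by_contra hpc
        simp [hpc] at hp
      exact ⟨hc, by simp [← hd]⟩
    · rw [norm₂_sq_of_diam_le_one hG hG3 hQ hc hd.ge]
      ring
  · have hX : 0 < norm₂ ρ ^ 2 := by
      rw [norm₂_sq]
      exact hρc.trans_le (Finset.single_le_sum (f := fun p => (ρ p : ℝ) ^ 2)
        (fun _ _ => sq_nonneg _) (Finset.mem_univ c))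
    refine ⟨_, fun p hp => ?_, le_trans (le_of_eq ?_)
      (le_energy_smul hβ (by positivity) (dirichlet_cast_le hdeg ρ) (s := norm₂ ρ ^ 2)
        (by rw [norm₂_sq]; exact Finset.sum_congr rfl fun _ _ => (sq _).symm))⟩
    · have hp : p ∈ supp ρ := mem_supp.mpr fun h0 => hp (by simp [h0])
      exact ⟨hp, by have := dist_le_diam (G := G) hp hc; lia⟩
    · push_cast
      field_simp
      ring

end BaseWave

section ChainDist

variable {V : Type*} {G : SimpleGraph V} {R : V → V → Prop} {B : Set V}

/-- The least number of steps of a chain from `B` to `p`. -/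
noncomputable def chainDist (G : SimpleGraph V) (R : V → V → Prop) (B : Set V) (p : V) : ℕ :=
  sInf {n | ∃ x ∈ B, Chain G R x p n}

lemma exists_chain_chainDist (hG : G.Connected) (hB : B.Nonempty) (p : V) :
    ∃ x ∈ B, Chain G R x p (chainDist G R B p) := by
  obtain ⟨x, hx⟩ := hB
  obtain ⟨w⟩ := hG.preconnected x p
  exact Nat.sInf_mem (s := {n | ∃ x ∈ B, Chain G R x p n}) ⟨_, x, hx, Chain.refl.append_walk w⟩

lemma chainDist_le {x p : V} {n : ℕ} (hx : x ∈ B) (h : Chain G R x p n) : chainDist G R B p ≤ n :=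
  Nat.sInf_le ⟨x, hx, h⟩

lemma chainDist_eq_zero {p : V} (hp : p ∈ B) : chainDist G R B p = 0 :=
  Nat.le_zero.mp (chainDist_le hp .refl)

lemma chainDist_le_of_adj (hG : G.Connected) (hB : B.Nonempty) {p q : V} (e : G.Adj p q) :
    chainDist G R B q ≤ chainDist G R B p + 1 := by
  obtain ⟨x, hx, h⟩ := exists_chain_chainDist (R := R) hG hB p
  exact chainDist_le hx (h.step e)

lemma chainDist_le_of_rel (hG : G.Connected) (hB : B.Nonempty) {p q : V} (e : R p q) :
    chainDist G R B q ≤ chainDist G R B p := by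
  obtain ⟨x, hx, h⟩ := exists_chain_chainDist (R := R) hG hB p
  exact chainDist_le hx (h.jump e)

end ChainDist

section Cutoff

/-- The piecewise linear cut-off that is `1` up to `2 ^ k` and `0` from `2 ^ (k + 1)` on. -/
noncomputable def cutoff (k n : ℕ) : ℝ := max 0 (min 1 (2 - (n : ℝ) / 2 ^ k))

lemma cutoff_of_le {k n : ℕ} (h : n ≤ 2 ^ k) : cutoff k n = 1 := by
  have : (n : ℝ) / 2 ^ k ≤ 1 := by
    rw [div_le_one (by positivity)]
    exact_mod_cast h
  rw [cutoff, min_eq_left (by linarith), max_eq_right zero_le_one]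

lemma cutoff_of_ge {k n : ℕ} (h : 2 ^ (k + 1) ≤ n) : cutoff k n = 0 := by
  have : 2 ≤ (n : ℝ) / 2 ^ k := by
    rw [le_div_iff₀ (by positivity), ← pow_succ']
    exact_mod_cast h
  exact max_eq_left ((min_le_right _ _).trans (by linarith))

lemma sq_cutoff_sub_le {k n m : ℕ} (hnm : n ≤ m + 1) (hmn : m ≤ n + 1) :
    (cutoff k n - cutoff k m) ^ 2 ≤ (1 / 2 ^ k) ^ 2 := by
  have hpos : (0 : ℝ) < 2 ^ k := by positivity
  have hlin : |(2 - (n : ℝ) / 2 ^ k) - (2 - (m : ℝ) / 2 ^ k)| ≤ 1 / 2 ^ k := by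
    have hnm' : (n : ℝ) ≤ m + 1 := by exact_mod_cast hnm
    have hmn' : (m : ℝ) ≤ n + 1 := by exact_mod_cast hmn
    rw [sub_sub_sub_cancel_left, ← sub_div, abs_div, abs_of_pos hpos]
    gcongr
    exact abs_le.mpr ⟨by linarith, by linarith⟩
  rw [sq_le_sq, abs_of_pos (by positivity : (0 : ℝ) < 1 / 2 ^ k)]
  refine ((abs_max_sub_max_le_max _ _ _ _).trans (max_le (by simp) ?_)).trans hlin
  exact (abs_min_sub_min_le_max _ _ _ _).trans (max_le (by simp) le_rfl)

end Cutoff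

section Islands

variable {V : Type*} [Fintype V]

/-- `B` is a charged part of `ρ` of diameter at most `2 ^ (k + 1)` that is far from the rest
of `ρ`. -/
structure IsIsland (G : SimpleGraph V) (ρ : V → ℤ) (k : ℕ) (B : Finset V) : Prop where
  nonempty : B.Nonempty
  subset : B ⊆ supp ρ
  dist_le : ∀ x ∈ B, ∀ y ∈ B, G.dist x y ≤ 2 ^ (k + 1)
  far : ∀ x ∈ B, ∀ y ∈ supp ρ, y ∉ B → 16 * 2 ^ (k + 1) ≤ G.dist x y
  exists_notMem : ∃ y ∈ supp ρ, y ∉ B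
  charge : ∑ x ∈ B, ρ x ≠ 0

/-- The cut-off function of an island `B`: it is `1` on `B` and decreases with the distance
from `B`, measured in steps of chains so that it is constant along jumps. -/
noncomputable def bump (G : SimpleGraph V) (R : V → V → Prop) (k : ℕ) (B : Finset V) (p : V) : ℝ :=
  cutoff k (chainDist G R B p)

variable {G : SimpleGraph V} {R : V → V → Prop} {ρ : V → ℤ} {k k' : ℕ} {B B' : Finset V}

namespace IsIsland

lemma mem_of_chain (hB : IsIsland G ρ k B) (hG : G.Connected)
    (hR : BoundedDistortion G R (supp ρ)) {y p : V} {n : ℕ} (hy : y ∈ supp ρ)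
    (hc : Chain G R y p n) (hn : n ≤ 2 ^ (k + 1)) (hp : chainDist G R B p ≤ 2 ^ (k + 1)) :
    y ∈ B := by
  by_contra hyB
  obtain ⟨x, hx, hxc⟩ := exists_chain_chainDist (R := R) hG hB.nonempty p
  have hxp := hR x (hB.subset hx) _ _ hxc
  have hyp := hR y hy _ _ hc
  have hxy := hG.dist_triangle (u := x) (v := p) (w := y)
  have hfar := hB.far x hx y hy hyB
  rw [SimpleGraph.dist_comm (u := p)] at hxy
  have : 0 < 2 ^ (k + 1) := by positivity
  lia

lemma chainDist_supp (hB : IsIsland G ρ k B) (hG : G.Connected)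
    (hR : BoundedDistortion G R (supp ρ)) {p : V} (hp : chainDist G R B p ≤ 2 ^ (k + 1)) :
    chainDist G R (supp ρ) p = chainDist G R B p := by
  obtain ⟨x, hx, hxc⟩ := exists_chain_chainDist (R := R) hG hB.nonempty p
  obtain ⟨y, hy, hyc⟩ :=
    exists_chain_chainDist (R := R) hG (hB.nonempty.mono hB.subset : (supp ρ).Nonempty) p
  have hle := chainDist_le (hB.subset hx) hxc
  exact hle.antisymm (chainDist_le (hB.mem_of_chain hG hR hy hyc (hle.trans hp) hp) hyc)

lemma sum_bump_mul (hB : IsIsland G ρ k B) (hG : G.Connected)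
    (hR : BoundedDistortion G R (supp ρ)) :
    ∑ p, bump G R k B p * (ρ p : ℝ) = ((∑ x ∈ B, ρ x : ℤ) : ℝ) := by
  rw [Int.cast_sum, ← Finset.sum_subset (Finset.subset_univ B)]
  · refine Finset.sum_congr rfl fun x hx => ?_
    rw [bump, chainDist_eq_zero (Finset.mem_coe.mpr hx), cutoff_of_le (Nat.zero_le _), one_mul]
  · intro y _ hyB
    by_cases hy : y ∈ supp ρ
    · have hfar : 2 ^ (k + 1) ≤ chainDist G R B y := by
        by_contra! h
        exact hyB (hB.mem_of_chain hG hR hy .refl (Nat.zero_le _) h.le)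
      rw [bump, cutoff_of_ge hfar, zero_mul]
    · simp [not_not.mp (mt mem_supp.mpr hy)]

lemma chainDist_of_bump_ne (hB : IsIsland G ρ k B) (hG : G.Connected) {p q : V}
    (e : G.Adj p q) (h : bump G R k B p ≠ bump G R k B q) :
    (2 ^ k ≤ chainDist G R B p ∧ chainDist G R B p ≤ 2 ^ (k + 1)) ∧
      (2 ^ k ≤ chainDist G R B q ∧ chainDist G R B q ≤ 2 ^ (k + 1)) ∧
      min (chainDist G R B p) (chainDist G R B q) < 2 ^ (k + 1) := by
  have hqp := chainDist_le_of_adj (R := R) hG hB.nonempty e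
  have hpq := chainDist_le_of_adj (R := R) hG hB.nonempty e.symm
  have hnear : ¬ (chainDist G R B p ≤ 2 ^ k ∧ chainDist G R B q ≤ 2 ^ k) := fun hc => h <| by
    rw [bump, bump, cutoff_of_le hc.1, cutoff_of_le hc.2]
  have hfar : ¬ (2 ^ (k + 1) ≤ chainDist G R B p ∧ 2 ^ (k + 1) ≤ chainDist G R B q) :=
    fun hc => h <| by rw [bump, bump, cutoff_of_ge hc.1, cutoff_of_ge hc.2]
  lia

lemma sq_bump_sub_le (hB : IsIsland G ρ k B) (hG : G.Connected)
    (hR : BoundedDistortion G R (supp ρ)) {z p q : V} (hz : z ∈ B) (e : G.Adj p q) :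
    (bump G R k B p - bump G R k B q) ^ 2 ≤
      {x | G.dist z x ≤ 10 * 2 ^ k}.indicator (fun _ => (1 / 2 ^ k : ℝ) ^ 2) p := by
  by_cases h : bump G R k B p = bump G R k B q
  · rw [h, sub_self, zero_pow two_ne_zero]
    exact Set.indicator_nonneg (fun _ _ => by positivity) p
  · obtain ⟨⟨-, hp⟩, -⟩ := hB.chainDist_of_bump_ne hG e h
    obtain ⟨x, hx, hxc⟩ := exists_chain_chainDist (R := R) hG hB.nonempty p
    have hxp := hR x (hB.subset hx) _ _ hxc
    have hzx := hB.dist_le z hz x hx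
    have hzp := hG.dist_triangle (u := z) (v := x) (w := p)
    rw [Set.indicator_of_mem (by rw [Set.mem_ofPred_eq]; rw [pow_succ] at hp hzx; lia)]
    exact sq_cutoff_sub_le (chainDist_le_of_adj hG hB.nonempty e.symm)
      (chainDist_le_of_adj hG hB.nonempty e)

lemma dirichlet_bump_le (hB : IsIsland G ρ k B) (hG : G.Connected)
    (hR : BoundedDistortion G R (supp ρ)) (hdeg : ∀ u, (G.neighborSet u).ncard ≤ 4)
    (hball : ∀ x r, {p | G.dist x p ≤ r}.ncard ≤ (2 * r + 1) ^ 2) :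
    dirichlet G (bump G R k B) ≤ 882 := by
  classical
  obtain ⟨z, hz⟩ := hB.nonempty
  set W : Set V := {p | G.dist z p ≤ 10 * 2 ^ k}
  set w : V → ℝ := fun p => W.indicator (fun _ => (1 / 2 ^ k : ℝ) ^ 2) p / 2 with hw_def
  have hw : ∀ p, 0 ≤ w p := fun p =>
    div_nonneg (Set.indicator_nonneg (fun _ _ => by positivity) p) two_pos.le
  have hsum : ∑ p, w p = W.ncard * ((1 / 2 ^ k) ^ 2 / 2) := by
    rw [hw_def, ← Finset.sum_div, Finset.sum_indicator_eq_sum_filter, Finset.sum_const,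
      nsmul_eq_mul, ← Set.ncard_coe_finset, mul_div_assoc]
    simp
  have hcard : (W.ncard : ℝ) ≤ 441 * (2 ^ k) ^ 2 := by
    have hone : (1 : ℝ) ≤ 2 ^ k := one_le_pow₀ one_le_two
    calc (W.ncard : ℝ) ≤ (2 * (10 * 2 ^ k) + 1) ^ 2 := by exact_mod_cast hball z (10 * 2 ^ k)
      _ ≤ (21 * 2 ^ k) ^ 2 := by gcongr; linarith
      _ = 441 * (2 ^ k) ^ 2 := by ring
  refine (dirichlet_le_of_sq_sub_le hdeg hw fun p q e => ?_).trans ?_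
  · have hp : _ ≤ W.indicator _ p := hB.sq_bump_sub_le hG hR hz e
    have hq : _ ≤ W.indicator _ q := hB.sq_bump_sub_le hG hR hz e.symm
    simp only [hw_def]
    linarith [sub_sq_comm (bump G R k B p) (bump G R k B q)]
  · rw [hsum]
    calc (4 : ℕ) * (W.ncard * ((1 / 2 ^ k) ^ 2 / 2))
        ≤ (4 : ℕ) * ((441 * (2 ^ k) ^ 2) * ((1 / 2 ^ k : ℝ) ^ 2 / 2)) := by gcongr
      _ = 882 := by field_simp; norm_num

lemma subset_of_mem (hB : IsIsland G ρ k B) (hB' : IsIsland G ρ k B') {x : V} (hx : x ∈ B)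
    (hx' : x ∈ B') : B ⊆ B' := by
  intro y hy
  by_contra hyB
  have hfar := hB'.far x hx' y (hB.subset hy) hyB
  have hdist := hB.dist_le x hx y hy
  have : 0 < 2 ^ (k + 1) := by positivity
  lia

lemma eq_of_bump_ne (hB : IsIsland G ρ k B) (hB' : IsIsland G ρ k' B') (hG : G.Connected)
    (hR : BoundedDistortion G R (supp ρ)) {p q : V} (e : G.Adj p q)
    (h : bump G R k B p ≠ bump G R k B q) (h' : bump G R k' B' p ≠ bump G R k' B' q) :
    k = k' ∧ B = B' := by
  obtain ⟨hp, hq, hpq⟩ := hB.chainDist_of_bump_ne hG e h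
  obtain ⟨hp', hq', hpq'⟩ := hB'.chainDist_of_bump_ne hG e h'
  have hpB := hB.chainDist_supp hG hR hp.2
  have hqB := hB.chainDist_supp hG hR hq.2
  have hpB' := hB'.chainDist_supp hG hR hp'.2
  have hqB' := hB'.chainDist_supp hG hR hq'.2
  obtain rfl : k = k' := by
    have hlt : k < k' + 1 := (Nat.pow_lt_pow_iff_right one_lt_two).mp (by lia)
    have hlt' : k' < k + 1 := (Nat.pow_lt_pow_iff_right one_lt_two).mp (by lia)
    lia
  obtain ⟨x, hx', hxc⟩ := exists_chain_chainDist (R := R) hG hB'.nonempty p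
  have hx := hB.mem_of_chain hG hR (hB'.subset hx') hxc hp'.2 hp.2
  exact ⟨rfl, (hB.subset_of_mem hB' hx hx').antisymm (hB'.subset_of_mem hB hx' hx)⟩

lemma bump_eq_of_mem_supp (hB : IsIsland G ρ k B) (hG : G.Connected)
    (hR : BoundedDistortion G R (supp ρ)) {p q : V} (e : G.Adj p q) (hp : p ∈ supp ρ) :
    bump G R k B p = bump G R k B q := by
  by_contra h
  obtain ⟨⟨hle, hle'⟩, -⟩ := hB.chainDist_of_bump_ne hG e h
  rw [← hB.chainDist_supp hG hR hle', chainDist_eq_zero (Finset.mem_coe.mpr hp)] at hle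
  exact absurd hle (not_le.mpr (by positivity))

lemma dist_add_two_le_of_bump_ne_zero (hB : IsIsland G ρ k B) (hG : G.Connected)
    (hR : BoundedDistortion G R (supp ρ)) {p c : V} (h : bump G R k B p ≠ 0) (hc : c ∈ supp ρ) :
    G.dist p c + 2 ≤ 2 * diam G ρ := by
  have hp : chainDist G R B p < 2 ^ (k + 1) := by
    by_contra! hge
    exact h (cutoff_of_ge hge)
  obtain ⟨x, hx, hxc⟩ := exists_chain_chainDist (R := R) hG hB.nonempty p
  obtain ⟨y, hy, hyB⟩ := hB.exists_notMem
  have hxp := hR x (hB.subset hx) _ _ hxc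
  have hfar := hB.far x hx y hy hyB
  have hxy := dist_le_diam (G := G) (hB.subset hx) hy
  have hcx := dist_le_diam (G := G) (hB.subset hx) hc
  have hpc := hG.dist_triangle (u := p) (v := x) (w := c)
  rw [SimpleGraph.dist_comm (u := p) (v := x)] at hpc
  lia

lemma bump_eq_of_rel (hB : IsIsland G ρ k B) (hG : G.Connected) {p q : V} (e : R p q)
    (e' : R q p) : bump G R k B p = bump G R k B q := by
  rw [bump, bump, (chainDist_le_of_rel hG hB.nonempty e').antisymm
    (chainDist_le_of_rel hG hB.nonempty e)]

end IsIsland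

end Islands

section Wave

variable {V : Type*} {G : SimpleGraph V} {R : V → V → Prop} {ρ : V → ℤ} {β : ℝ}
  {k : ℕ} {B : Finset V}

/-- The spin wave of an island `B` of `ρ`: the multiple of its cut-off function whose energy
the bound `882` on the Dirichlet form of the cut-off controls best. -/
noncomputable def islandWave (G : SimpleGraph V) (R : V → V → Prop) (β : ℝ) (ρ : V → ℤ) (k : ℕ)
    (B : Finset V) : V → ℝ :=
  (((∑ x ∈ B, ρ x : ℤ) : ℝ) / (β * 882)) • bump G R k B

lemma bump_ne_of_islandWave_ne {p q : V}
    (h : islandWave G R β ρ k B p ≠ islandWave G R β ρ k B q) :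
    bump G R k B p ≠ bump G R k B q := fun hb => h <| by
  rw [islandWave, Pi.smul_apply, Pi.smul_apply, hb]

lemma bump_ne_zero_of_islandWave_ne_zero {p : V} (h : islandWave G R β ρ k B p ≠ 0) :
    bump G R k B p ≠ 0 := fun hb => h <| by
  rw [islandWave, Pi.smul_apply, hb, smul_zero]

variable [Fintype V]

lemma IsIsland.le_energy_islandWave (hB : IsIsland G ρ k B) (hG : G.Connected)
    (hR : BoundedDistortion G R (supp ρ)) (hdeg : ∀ u, (G.neighborSet u).ncard ≤ 4)
    (hball : ∀ x r, {p | G.dist x p ≤ r}.ncard ≤ (2 * r + 1) ^ 2) (hβ : 0 < β) :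
    1 / β * (1 / 1764) ≤ energy G β (islandWave G R β ρ k B) ρ := by
  have hs : (1 : ℝ) ≤ ((∑ x ∈ B, ρ x : ℤ) : ℝ) ^ 2 := by
    rw [one_le_sq_iff_one_le_abs]
    exact_mod_cast Int.one_le_abs hB.charge
  refine le_trans ?_ (le_energy_smul hβ (by norm_num) (hB.dirichlet_bump_le hG hR hdeg hball)
    (hB.sum_bump_mul hG hR))
  gcongr 1 / β * ?_
  linarith

lemma le_energy_add_sum_islandWave (hG : G.Connected) (hdeg : ∀ u, (G.neighborSet u).ncard ≤ 4)
    (hball : ∀ x r, {p | G.dist x p ≤ r}.ncard ≤ (2 * r + 1) ^ 2) (hβ : 0 < β)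
    (hR : BoundedDistortion G R (supp ρ)) {T : Finset (ℕ × Finset V)}
    (hT : ∀ i ∈ T, IsIsland G ρ i.1 i.2) {a : V → ℝ} (ha : ∀ p, a p ≠ 0 → p ∈ supp ρ) :
    energy G β a ρ + 1 / β * (1 / 1764 * (T.card : ℝ)) ≤
      energy G β (a + ∑ i ∈ T, islandWave G R β ρ i.1 i.2) ρ := by
  rw [energy_add, energy_sum]
  · have hsum := Finset.card_nsmul_le_sum T _ _ fun i hi =>
      (hT i hi).le_energy_islandWave hG hR hdeg hball hβ
    rw [nsmul_eq_mul] at hsum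
    linarith
  · intro i hi j hj hij p q e
    by_contra! h
    obtain ⟨hk, hB⟩ := (hT i hi).eq_of_bump_ne (hT j hj) hG hR e (bump_ne_of_islandWave_ne h.1)
      (bump_ne_of_islandWave_ne h.2)
    exact hij (Prod.ext hk hB)
  · intro p q e
    by_contra! h
    obtain ⟨hapq, hsum⟩ := h
    obtain ⟨i, hi, hne⟩ : ∃ i ∈ T, islandWave G R β ρ i.1 i.2 p ≠ islandWave G R β ρ i.1 i.2 q := by
      by_contra! heq
      simp only [Finset.sum_apply, Finset.sum_congr rfl heq, ne_eq, not_true] at hsum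
    have hbump := bump_ne_of_islandWave_ne hne
    by_cases hp : a p = 0
    · have hq : a q ≠ 0 := fun hq => hapq (hp.trans hq.symm)
      exact hbump ((hT i hi).bump_eq_of_mem_supp hG hR e.symm (ha q hq)).symm
    · exact hbump ((hT i hi).bump_eq_of_mem_supp hG hR e (ha p hp))

theorem exists_wave (hG : G.Connected) (hG3 : G.CliqueFree 3)
    (hdeg : ∀ u, (G.neighborSet u).ncard ≤ 4)
    (hball : ∀ x r, {p | G.dist x p ≤ r}.ncard ≤ (2 * r + 1) ^ 2) (hβ : 0 < β)
    (hQ : charge ρ = 0) {c : V} (hc : c ∈ supp ρ) (hsymm : ∀ p q, R p q → R q p)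
    (hout : ∀ p q, R p q → p ∉ supp ρ) (hR : BoundedDistortion G R (supp ρ))
    {T : Finset (ℕ × Finset V)} (hT : ∀ i ∈ T, IsIsland G ρ i.1 i.2) :
    ∃ a : V → ℝ, (∀ p q, R p q → a p = a q) ∧
      (∀ p, a p ≠ 0 → G.dist p c + 2 ≤ 2 * diam G ρ) ∧
      1 / β * (1 / 16 * norm₂ ρ ^ 2 + 1 / 1764 * (T.card : ℝ)) ≤ energy G β a ρ := by
  obtain ⟨a₀, ha₀, henergy⟩ := exists_baseWave hG hG3 hdeg hβ hQ hc
  have hzero : ∀ p, p ∉ supp ρ → a₀ p = 0 := fun p hp => by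
    by_contra h
    exact hp (ha₀ p h).1
  refine ⟨a₀ + ∑ i ∈ T, islandWave G R β ρ i.1 i.2, fun p q e => ?_, fun p hp => ?_, ?_⟩
  · simp only [Pi.add_apply, Finset.sum_apply, islandWave, Pi.smul_apply,
      hzero p (hout p q e), hzero q (hout q p (hsymm p q e))]
    congr 1
    exact Finset.sum_congr rfl fun i hi => by
      rw [(hT i hi).bump_eq_of_rel hG e (hsymm p q e)]
  · by_cases h : a₀ p = 0
    · rw [Pi.add_apply, h, zero_add, Finset.sum_apply] at hp
      obtain ⟨i, hi, hip⟩ := Finset.exists_ne_zero_of_sum_ne_zero hp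
      exact (hT i hi).dist_add_two_le_of_bump_ne_zero hG hR
        (bump_ne_zero_of_islandWave_ne_zero hip) hc
    · exact (ha₀ p h).2
  · refine le_trans ?_
      (le_energy_add_sum_islandWave hG hdeg hball hβ hR hT fun p hp => (ha₀ p hp).1)
    rw [mul_add]
    gcongr

end Wave

section Exponents

variable {α : ℝ}

lemma natCast_le_rpow (hα : 1 ≤ α) (n : ℕ) : (n : ℝ) ≤ (n : ℝ) ^ α := by
  rcases Nat.eq_zero_or_pos n with rfl | hn
  · rw [Nat.cast_zero, Real.zero_rpow (by linarith)]
  · exact Real.self_le_rpow_of_one_le (by exact_mod_cast hn) hα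

lemma eight_pow_le_four_mul_rpow (hα : 3 / 2 ≤ α) {m n : ℕ} (h : 4 ^ m ≤ 2 * n) :
    (8 : ℝ) ^ m ≤ 4 * (n : ℝ) ^ α := by
  have hn : (1 : ℝ) ≤ n := by
    have : 0 < 4 ^ m := by positivity
    exact_mod_cast (by lia : 1 ≤ n)
  have hsq : ((8 : ℝ) ^ m) ^ 2 ≤ (4 * (n : ℝ) ^ (3 / 2 : ℝ)) ^ 2 :=
    calc ((8 : ℝ) ^ m) ^ 2 = ((4 : ℝ) ^ m) ^ 3 := by
          rw [← pow_mul, ← pow_mul, mul_comm m 2, mul_comm m 3, pow_mul, pow_mul]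
          norm_num
      _ ≤ (2 * (n : ℝ)) ^ 3 := by
          gcongr
          exact_mod_cast h
      _ ≤ 16 * (n : ℝ) ^ 3 := by
          rw [mul_pow]
          gcongr
          norm_num
      _ = (4 * (n : ℝ) ^ (3 / 2 : ℝ)) ^ 2 := by
          rw [mul_pow, ← Real.rpow_mul_natCast (Nat.cast_nonneg n)]
          norm_num
  calc (8 : ℝ) ^ m ≤ 4 * (n : ℝ) ^ (3 / 2 : ℝ) :=
        (pow_le_pow_iff_left₀ (by positivity) (by positivity) two_ne_zero).mp hsq
    _ ≤ 4 * (n : ℝ) ^ α := by gcongr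

end Exponents

section SetDist

variable {V : Type*} {G : SimpleGraph V} {A B : Finset V}

lemma setDist_le {x y : V} (hx : x ∈ A) (hy : y ∈ B) : setDist G A B ≤ G.dist x y :=
  Nat.sInf_le ⟨x, hx, y, hy, rfl⟩

lemma exists_dist_eq_setDist (hA : A.Nonempty) (hB : B.Nonempty) :
    ∃ x ∈ A, ∃ y ∈ B, G.dist x y = setDist G A B := by
  obtain ⟨x, hx⟩ := hA
  obtain ⟨y, hy⟩ := hB
  exact Nat.sInf_mem (s := {n | ∃ i ∈ A, ∃ j ∈ B, G.dist i j = n}) ⟨_, x, hx, y, hy, rfl⟩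

end SetDist

section Separation

variable {V : Type*} [Fintype V] {G : SimpleGraph V} {center : (V → ℤ) → V} {α : ℝ}
  {N : Finset (V → ℤ)} {ρ ρ' : V → ℤ}

lemma mem_neutral : ρ ∈ neutral N ↔ ρ ∈ N ∧ charge ρ = 0 := Finset.mem_filter

lemma mem_smaller {N₀ : Finset (V → ℤ)} :
    ρ' ∈ smaller G N₀ ρ ↔ ρ' ∈ N₀ ∧ diam G ρ' ≤ 2 * diam G ρ ∧ ρ ≠ ρ' := Finset.mem_filter

namespace IsSeparated

lemma le_dist (hsep : IsSeparated G α N) (hρ : ρ ∈ N) (hρ' : ρ' ∈ N) (hne : ρ ≠ ρ') {x y : V}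
    (hx : x ∈ supp ρ) (hy : y ∈ supp ρ') :
    65536 * ((min (diam G ρ) (diam G ρ') : ℕ) : ℝ) ^ α ≤ G.dist x y := by
  have hfar := hsep.far ρ hρ ρ' hρ' hne
  norm_num only [M] at hfar
  exact hfar.trans (by exact_mod_cast setDist_le hx hy)

lemma min_diam_le_dist (hsep : IsSeparated G α N) (hα : 1 ≤ α) (hρ : ρ ∈ N) (hρ' : ρ' ∈ N)
    (hne : ρ ≠ ρ') {x y : V} (hx : x ∈ supp ρ) (hy : y ∈ supp ρ') :
    65536 * min (diam G ρ) (diam G ρ') ≤ G.dist x y := by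
  have hdist := hsep.le_dist hρ hρ' hne hx hy
  have hrpow := natCast_le_rpow hα (min (diam G ρ) (diam G ρ'))
  have : (65536 : ℝ) * (min (diam G ρ) (diam G ρ') : ℕ) ≤ G.dist x y := by linarith
  exact_mod_cast this

lemma eight_pow_le_dist (hsep : IsSeparated G α N) (hα : 3 / 2 ≤ α) (hρ : ρ ∈ N) (hρ' : ρ' ∈ N)
    (hne : ρ ≠ ρ') {x y : V} (hx : x ∈ supp ρ) (hy : y ∈ supp ρ') {m : ℕ}
    (hm : 4 ^ m ≤ 2 * min (diam G ρ) (diam G ρ')) : 16384 * 8 ^ m ≤ G.dist x y := by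
  have hdist := hsep.le_dist hρ hρ' hne hx hy
  have hpow := eight_pow_le_four_mul_rpow hα hm
  have : (16384 * 8 ^ m : ℝ) ≤ G.dist x y := by linarith
  exact_mod_cast this

end IsSeparated

lemma dist_center_le_of_mem_DPlus (hG : G.Connected) {p : V} (hp : p ∈ DPlus G center ρ) :
    G.dist p (center ρ) ≤ 2 * diam G ρ := by
  obtain ⟨i, hi, hpi⟩ := hp
  have htri := hG.dist_triangle (u := p) (v := i) (w := center ρ)
  rw [D, Set.mem_ofPred_eq] at hi
  lia

lemma isSparse_DPlus (hG : G.Connected) (hα : 3 / 2 ≤ α) (hcenter : IsCenterChoice G center)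
    (hN : IsEnsemble N) (hsep : IsSeparated G α N) {F : Finset (V → ℤ)} (hF : F ⊆ neutral N) :
    IsSparse G (DPlus G center) center (diam G) F := by
  have hmem : ∀ ρ ∈ F, ρ ∈ N := fun ρ hρ => (mem_neutral.mp (hF hρ)).1
  have hsupp : ∀ ρ ∈ F, center ρ ∈ supp ρ := fun ρ hρ => (hcenter ρ (hN.1 ρ (hmem ρ hρ))).1
  have hone : ∀ ρ ∈ F, 1 ≤ diam G ρ := fun ρ hρ =>
    one_le_diam hG (mem_neutral.mp (hF hρ)).2 (hsupp ρ hρ)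
  refine ⟨fun ρ _ p hp => dist_center_le_of_mem_DPlus hG hp, fun ρ hρ => ?_, hone,
    fun ρ hρ ρ' hρ' hne m hm hm' => ?_⟩
  · have := hone ρ hρ
    refine ⟨center ρ, ?_, by simp⟩
    rw [D, Set.mem_ofPred_eq, SimpleGraph.dist_self]
    lia
  · exact hsep.eight_pow_le_dist hα (hmem ρ hρ) (hmem ρ' hρ') hne (hsupp ρ hρ) (hsupp ρ' hρ')
      (by lia)

lemma boundedDistortion_DPlus (hG : G.Connected) (hα : 3 / 2 ≤ α)
    (hcenter : IsCenterChoice G center) (hN : IsEnsemble N) (hsep : IsSeparated G α N)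
    (hρ : ρ ∈ N) :
    BoundedDistortion G (Joined (DPlus G center) (smaller G (neutral N) ρ)) (supp ρ) := by
  refine (isSparse_DPlus hG hα hcenter hN hsep (Finset.filter_subset _ _)).boundedDistortion hG
    (Finset.finite_toSet _) fun x hx ρ' hρ' m hm => ?_
  obtain ⟨hρ'N, hdiam, hne⟩ := mem_smaller.mp hρ'
  obtain ⟨hρ'N, -⟩ := mem_neutral.mp hρ'N
  exact hsep.eight_pow_le_dist hα hρ hρ'N hne hx (hcenter ρ' (hN.1 ρ' hρ'N)).1 (by lia)

lemma notMem_supp_of_mem_DPlus (hG : G.Connected) (hα : 1 ≤ α)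
    (hcenter : IsCenterChoice G center) (hN : IsEnsemble N) (hsep : IsSeparated G α N)
    (hρ : ρ ∈ N) (hρ' : ρ' ∈ smaller G (neutral N) ρ) {p : V} (hp : p ∈ DPlus G center ρ') :
    p ∉ supp ρ := by
  intro hps
  obtain ⟨hρ'N, hdiam, hne⟩ := mem_smaller.mp hρ'
  obtain ⟨hρ'N, hQ⟩ := mem_neutral.mp hρ'N
  have hc := (hcenter ρ' (hN.1 ρ' hρ'N)).1
  have hfar := hsep.min_diam_le_dist hα hρ hρ'N hne hps hc
  have hnear := dist_center_le_of_mem_DPlus hG hp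
  have hone := one_le_diam hG hQ hc
  lia

lemma disjoint_support_of_notMem_smaller (hα : 1 ≤ α) (hsep : IsSeparated G α N) (hρ : ρ ∈ N)
    (hρ' : ρ' ∈ neutral N) (hne : ρ' ≠ ρ) (hlarge : ρ' ∉ smaller G (neutral N) ρ) {a : V → ℝ}
    {c : V} (hc : c ∈ supp ρ) (ha : ∀ p, a p ≠ 0 → G.dist p c + 2 ≤ 2 * diam G ρ) :
    Disjoint (Function.support a) (Function.support ρ') := by
  refine Set.disjoint_left.mpr fun p hp hp' => ?_
  have hdiam : 2 * diam G ρ < diam G ρ' := by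
    by_contra! h
    exact hlarge (mem_smaller.mpr ⟨hρ', h, hne.symm⟩)
  have hfar := hsep.min_diam_le_dist hα (mem_neutral.mp hρ').1 hρ hne (mem_supp.mpr hp') hc
  have hnear := ha p hp
  lia

lemma support_laplacian_subset_D (hG : G.Connected) {a : V → ℝ}
    (ha : ∀ p, a p ≠ 0 → G.dist p (center ρ) + 2 ≤ 2 * diam G ρ) :
    Function.support (laplacian G a) ⊆ D G center ρ := by
  intro p hp
  rw [D, Set.mem_ofPred_eq]
  obtain ⟨q, -, hq⟩ := Finset.exists_ne_zero_of_sum_ne_zero hp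
  simp only [ne_eq, ite_eq_right_iff, not_forall, sub_eq_zero] at hq
  obtain ⟨e, hq⟩ := hq
  have htri := hG.dist_triangle (u := p) (v := q) (w := center ρ)
  rw [SimpleGraph.dist_eq_one_iff_adj.mpr e] at htri
  by_cases hap : a p = 0
  · have := ha q (hap ▸ hq)
    lia
  · have := ha p hap
    lia

end Separation

section Splitting

variable {V : Type*} [Fintype V] {G : SimpleGraph V} {α : ℝ} {N : Finset (V → ℤ)} {ρ : V → ℤ}

lemma mem_supp_indicator {s : Set V} {p : V} : p ∈ supp (s.indicator ρ) ↔ p ∈ s ∧ p ∈ supp ρ := by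
  rw [mem_supp, mem_supp, Set.indicator_apply_ne_zero, Set.mem_inter_iff, Function.mem_support]

lemma ne_zero_of_mem_supp {p : V} (hp : p ∈ supp ρ) : ρ ≠ 0 :=
  fun h => mem_supp.mp hp (congrFun h p)

lemma IsSeparated.charge_ne_zero (hsep : IsSeparated G α N) (hα : 0 ≤ α) (hρ : ρ ∈ N)
    (hQ : charge ρ = 0) {r : ℕ} {B : Finset V} (hB : B.Nonempty) (hBρ : B ⊆ supp ρ)
    (hBc : ∃ y ∈ supp ρ, y ∉ B) (hdist : ∀ x ∈ B, ∀ y ∈ B, G.dist x y ≤ r)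
    (hfar : ∀ x ∈ B, ∀ y ∈ supp ρ, y ∉ B → 2 * M * (r : ℝ) ^ α ≤ G.dist x y) :
    ∑ x ∈ B, ρ x ≠ 0 := by
  set ρ₁ : V → ℤ := (B : Set V).indicator ρ
  set ρ₂ : V → ℤ := ((B : Set V)ᶜ).indicator ρ
  obtain ⟨x, hx⟩ := hB
  obtain ⟨y, hy, hyB⟩ := hBc
  have hx₁ : x ∈ supp ρ₁ := mem_supp_indicator.mpr ⟨hx, hBρ hx⟩
  have hy₂ : y ∈ supp ρ₂ := mem_supp_indicator.mpr ⟨hyB, hy⟩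
  have hcharge : charge ρ₁ = ∑ x ∈ B, ρ x :=
    Finset.sum_indicator_subset ρ (Finset.subset_univ B)
  have hdiam : min (diam G ρ₁) (diam G ρ₂) ≤ r := by
    refine (min_le_left _ _).trans (Finset.sup_le fun p hp => ?_)
    obtain ⟨hp, hp'⟩ := Finset.mem_product.mp hp
    exact hdist _ (mem_supp_indicator.mp hp).1 _ (mem_supp_indicator.mp hp').1
  have hsplit : 2 * M * ((min (diam G ρ₁) (diam G ρ₂) : ℕ) : ℝ) ^ α ≤ chargeDist G ρ₁ ρ₂ := by
    obtain ⟨p, hp, q, hq, hpq⟩ := exists_dist_eq_setDist (G := G) ⟨x, hx₁⟩ ⟨y, hy₂⟩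
    obtain ⟨hqB, hq⟩ := mem_supp_indicator.mp hq
    have hM : 0 ≤ M := by norm_num [M]
    rw [chargeDist, ← hpq]
    refine le_trans ?_ (hfar p (mem_supp_indicator.mp hp).1 q hq hqB)
    gcongr
  rw [← hcharge]
  refine (hsep.decomposition ρ hρ hQ ρ₁ ρ₂ (ne_zero_of_mem_supp hx₁) (ne_zero_of_mem_supp hy₂)
    (Finset.disjoint_left.mpr fun p hp hp' => ?_) (Set.indicator_self_add_compl _ ρ).symm
    hsplit).1
  exact (mem_supp_indicator.mp hp').1 (mem_supp_indicator.mp hp).1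

lemma IsSeparated.isIsland (hsep : IsSeparated G α N) (hα : 1 ≤ α) (hρ : ρ ∈ N)
    (hQ : charge ρ = 0) {k : ℕ} {B : Finset V} (hB : B.Nonempty) (hBρ : B ⊆ supp ρ)
    (hBc : ∃ y ∈ supp ρ, y ∉ B) (hdist : ∀ x ∈ B, ∀ y ∈ B, G.dist x y ≤ 2 ^ (k + 1))
    (hfar : ∀ x ∈ B, ∀ y ∈ supp ρ, y ∉ B →
      2 * M * ((2 ^ (k + 1) : ℕ) : ℝ) ^ α ≤ G.dist x y) : IsIsland G ρ k B := by
  refine ⟨hB, hBρ, hdist, fun x hx y hy hyB => ?_, hBc,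
    hsep.charge_ne_zero (by linarith) hρ hQ hB hBρ hBc hdist hfar⟩
  have hrpow := natCast_le_rpow hα (2 ^ (k + 1))
  have hxy := hfar x hx y hy hyB
  norm_num only [M] at hxy
  have : (16 : ℝ) * (2 ^ (k + 1) : ℕ) ≤ G.dist x y := by linarith
  exact_mod_cast this

end Splitting

section Squares

variable {α : ℝ} {k : ℕ}

section Separated

variable {V : Type*} [Fintype V] [DecidableEq V] {G : SimpleGraph V} {C : Finset (Finset V)}
  {s t : Finset V}

lemma mem_separatedSquares : s ∈ separatedSquares G α k C ↔ C.card ≠ 1 ∧ s ∈ C ∧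
    ∀ t ∈ C, t ≠ s → 2 * M * (2 : ℝ) ^ (α * ((k : ℝ) + 1)) ≤ (setDist G t s : ℝ) := by
  unfold separatedSquares
  split_ifs with h <;> simp [h]

lemma eq_of_mem_separatedSquares (hs : s ∈ separatedSquares G α k C) (ht : t ∈ C) {x : V}
    (hxs : x ∈ s) (hxt : x ∈ t) : t = s := by
  by_contra hne
  have hfar := (mem_separatedSquares.mp hs).2.2 t ht hne
  have hzero : setDist G t s = 0 := by
    rw [← Nat.le_zero, ← SimpleGraph.dist_self (G := G) (v := x)]
    exact setDist_le hxt hxs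
  rw [hzero, Nat.cast_zero, M] at hfar
  exact absurd hfar (not_le.mpr (by positivity))

end Separated

variable {bc : BoundaryCondition} {L : ℕ}
  {S : ℕ → (Fin L × Fin L → ℤ) → Finset (Finset (Fin L × Fin L))}
  {N : Finset (Fin L × Fin L → ℤ)} {ρ : Fin L × Fin L → ℤ} {s : Finset (Fin L × Fin L)}

lemma IsMinimalCoverChoice.inter_nonempty (hS : IsMinimalCoverChoice bc L S) (h0 : ρ ≠ 0)
    (hs : s ∈ S k ρ) : (supp ρ ∩ s).Nonempty := by
  by_contra! h
  obtain ⟨⟨hsq, hcov⟩, hmin⟩ := hS k ρ h0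
  have hle := hmin ((S k ρ).erase s) ⟨fun t ht => hsq t (Finset.mem_of_mem_erase ht),
    fun j hj => by
      obtain ⟨t, ht, hjt⟩ := hcov j hj
      refine ⟨t, Finset.mem_erase.mpr ⟨?_, ht⟩, hjt⟩
      rintro rfl
      exact Finset.eq_empty_iff_forall_notMem.mp h j (Finset.mem_inter.mpr ⟨hj, hjt⟩)⟩
  exact absurd hle (not_le.mpr (Finset.card_erase_lt_of_mem hs))

lemma isIsland_of_mem_separatedSquares [NeZero L] (hα : 1 ≤ α)
    (hS : IsMinimalCoverChoice bc L S) (hsep : IsSeparated (squareDomain bc L) α N) (hρ : ρ ∈ N)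
    (h0 : ρ ≠ 0) (hQ : charge ρ = 0)
    (hs : s ∈ separatedSquares (squareDomain bc L) α k (S k ρ)) :
    IsIsland (squareDomain bc L) ρ k (supp ρ ∩ s) := by
  obtain ⟨hcard, hsS, hfar⟩ := mem_separatedSquares.mp hs
  obtain ⟨⟨hsq, hcov⟩, -⟩ := hS k ρ h0
  have hrpow : ((2 ^ (k + 1) : ℕ) : ℝ) ^ α = 2 ^ (α * ((k : ℝ) + 1)) := by
    rw [mul_comm, Real.rpow_mul two_pos.le]
    norm_cast
  refine hsep.isIsland hα hρ hQ (hS.inter_nonempty h0 hsS) Finset.inter_subset_left ?_ ?_ ?_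
  · have : 1 < (S k ρ).card := by
      have := Finset.card_pos.mpr ⟨s, hsS⟩
      lia
    obtain ⟨t, ht, hts⟩ := Finset.exists_mem_ne this s
    obtain ⟨y, hy⟩ := hS.inter_nonempty h0 ht
    rw [Finset.mem_inter] at hy
    refine ⟨y, hy.1, fun hyB => hts ?_⟩
    exact eq_of_mem_separatedSquares hs ht (Finset.mem_inter.mp hyB).2 hy.2
  · exact fun x hx y hy => dist_le_of_isSquare (hsq s hsS) (Finset.mem_inter.mp hx).2
      (Finset.mem_inter.mp hy).2
  · intro x hx y hy hyB
    obtain ⟨t, ht, hyt⟩ := hcov y hy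
    have hts : t ≠ s := by
      rintro rfl
      exact hyB (Finset.mem_inter.mpr ⟨hy, hyt⟩)
    rw [hrpow, SimpleGraph.dist_comm]
    exact (hfar t ht hts).trans (by exact_mod_cast setDist_le hyt (Finset.mem_inter.mp hx).2)

lemma separatedSquares_eq_empty (hS : IsMinimalCoverChoice bc L S) (h0 : ρ ≠ 0)
    (hk : L < 2 ^ k) : separatedSquares (squareDomain bc L) α k (S k ρ) = ∅ := by
  obtain ⟨⟨hsq, hcov⟩, -⟩ := hS k ρ h0
  have huniv : ∀ s ∈ S k ρ, s = Finset.univ := fun s hs => by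
    simpa only [not_le.mpr hk, if_false] using (hsq s hs).2
  have hcard : (S k ρ).card = 1 := by
    obtain ⟨p, hp⟩ := Function.ne_iff.mp h0
    obtain ⟨s, hs, -⟩ := hcov p (mem_supp.mpr hp)
    exact Finset.card_eq_one.mpr
      ⟨Finset.univ, Finset.eq_singleton_iff_unique_mem.mpr ⟨huniv s hs ▸ hs, huniv⟩⟩
  rw [separatedSquares, if_pos hcard]

/-- The islands that the separated squares cut out of `ρ`, together with their scales. The scales
`k > L` are left out because there are no separated squares when `2 ^ k > L`. -/
noncomputable def islands (bc : BoundaryCondition) (L : ℕ) (α : ℝ)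
    (S : ℕ → (Fin L × Fin L → ℤ) → Finset (Finset (Fin L × Fin L))) (ρ : Fin L × Fin L → ℤ) :
    Finset (ℕ × Finset (Fin L × Fin L)) :=
  ((Finset.range L).sigma fun k =>
    separatedSquares (squareDomain bc L) α (k + 1) (S (k + 1) ρ)).image
      fun i => (i.1 + 1, supp ρ ∩ i.2)

lemma isIsland_of_mem_islands [NeZero L] (hα : 1 ≤ α) (hS : IsMinimalCoverChoice bc L S)
    (hsep : IsSeparated (squareDomain bc L) α N) (hρ : ρ ∈ N) (h0 : ρ ≠ 0) (hQ : charge ρ = 0)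
    {i : ℕ × Finset (Fin L × Fin L)} (hi : i ∈ islands bc L α S ρ) :
    IsIsland (squareDomain bc L) ρ i.1 i.2 := by
  obtain ⟨⟨k, s⟩, hs, rfl⟩ := Finset.mem_image.mp hi
  exact isIsland_of_mem_separatedSquares hα hS hsep hρ h0 hQ (Finset.mem_sigma.mp hs).2

lemma card_islands (hS : IsMinimalCoverChoice bc L S) (h0 : ρ ≠ 0) :
    (islands bc L α S ρ).card = ∑ k ∈ Finset.range L,
      (separatedSquares (squareDomain bc L) α (k + 1) (S (k + 1) ρ)).card := by
  rw [islands, Finset.card_image_of_injOn, Finset.card_sigma]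
  rintro ⟨k, s⟩ hs ⟨k', s'⟩ hs' h
  simp only [Finset.coe_sigma, Set.mem_sigma_iff, Finset.mem_coe] at hs hs'
  simp only [Prod.mk.injEq, add_left_inj] at h
  obtain ⟨rfl, h⟩ := h
  obtain ⟨x, hx⟩ := hS.inter_nonempty h0 (mem_separatedSquares.mp hs.2).2.1
  rw [eq_of_mem_separatedSquares hs.2 (mem_separatedSquares.mp hs'.2).2.1
    (Finset.mem_inter.mp hx).2 (Finset.mem_inter.mp (h ▸ hx)).2]

lemma hasSum_card_separatedSquares (hS : IsMinimalCoverChoice bc L S) (h0 : ρ ≠ 0) :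
    HasSum (fun k : ℕ =>
      ((separatedSquares (squareDomain bc L) α (k + 1) (S (k + 1) ρ)).card : ℝ))
      (islands bc L α S ρ).card := by
  rw [card_islands hS h0, Nat.cast_sum]
  refine hasSum_sum_of_ne_finset_zero fun k hk => ?_
  have hLk : L < 2 ^ (k + 1) :=
    Nat.lt_two_pow_self.trans_le (Nat.pow_le_pow_right two_pos <| by
      rw [Finset.mem_range] at hk
      lia)
  rw [separatedSquares_eq_empty hS h0 hLk, Finset.card_empty, Nat.cast_zero]

end Squares

end SpinWave

theorem proposition2p4_general :
    ∃ D₃ : ℝ, 0 < D₃ ∧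
      ∀ (α : ℝ), 3 / 2 ≤ α →
      ∀ (bc : SpinWave.BoundaryCondition) (L : ℕ),
      (bc = SpinWave.BoundaryCondition.periodic → L ≠ 3) →
      ∀ (β : ℝ), 0 < β →
      ∀ (center : (Fin L × Fin L → ℤ) → Fin L × Fin L),
      SpinWave.IsCenterChoice (SpinWave.squareDomain bc L) center →
      ∀ (S : ℕ → (Fin L × Fin L → ℤ) → Finset (Finset (Fin L × Fin L))),
      SpinWave.IsMinimalCoverChoice bc L S →
      ∀ (N : Finset (Fin L × Fin L → ℤ)),
      SpinWave.IsEnsemble N →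
      SpinWave.IsSeparated (SpinWave.squareDomain bc L) α N →
      ∀ ρ ∈ SpinWave.neutral N, ∃ a : Fin L × Fin L → ℝ,
        (∀ ρ' ∈ SpinWave.smaller (SpinWave.squareDomain bc L) (SpinWave.neutral N) ρ,
          ∀ i ∈ SpinWave.DPlus (SpinWave.squareDomain bc L) center ρ',
          ∀ j ∈ SpinWave.DPlus (SpinWave.squareDomain bc L) center ρ', a i = a j) ∧
        Function.support a ⊆ SpinWave.D (SpinWave.squareDomain bc L) center ρ ∧
        (∀ ρ' ∈ SpinWave.neutral N, ρ' ≠ ρ →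
          ρ' ∉ SpinWave.smaller (SpinWave.squareDomain bc L) (SpinWave.neutral N) ρ →
          Disjoint (Function.support a) (Function.support ρ')) ∧
        Function.support (SpinWave.laplacian (SpinWave.squareDomain bc L) a) ⊆
          SpinWave.D (SpinWave.squareDomain bc L) center ρ ∧
        Summable (fun k : ℕ =>
          ((SpinWave.separatedSquares (SpinWave.squareDomain bc L) α (k + 1)
            (S (k + 1) ρ)).card : ℝ)) ∧
        1 / β * (1 / 16 * SpinWave.norm₂ ρ ^ 2 +
            D₃ * ∑' k : ℕ, ((SpinWave.separatedSquares (SpinWave.squareDomain bc L) α (k + 1)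
              (S (k + 1) ρ)).card : ℝ)) ≤
          SpinWave.energy (SpinWave.squareDomain bc L) β a ρ := by
  refine ⟨1 / 1764, by norm_num, ?_⟩
  intro α hα bc L h3 β hβ center hcenter S hS N hN hsep ρ hρ
  have hα' : 1 ≤ α := by linarith
  obtain ⟨hρN, hQ⟩ := SpinWave.mem_neutral.mp hρ
  have h0 := hN.1 ρ hρN
  have hc := (hcenter ρ h0).1
  have : NeZero L := ⟨(center ρ).1.pos.ne'⟩
  have hG := SpinWave.squareDomain_connected (L := L) bc
  obtain ⟨a, hconst, hsupp, henergy⟩ := SpinWave.exists_wave hG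
    (SpinWave.squareDomain_cliqueFree_three h3) SpinWave.ncard_neighborSet_squareDomain_le
    SpinWave.ncard_ball_squareDomain_le hβ hQ hc
    (fun _ _ ⟨ρ', h, hp, hq⟩ => ⟨ρ', h, hq, hp⟩)
    (fun _ _ ⟨_, h, hp, _⟩ => SpinWave.notMem_supp_of_mem_DPlus hG hα' hcenter hN hsep hρN h hp)
    (SpinWave.boundedDistortion_DPlus hG hα hcenter hN hsep hρN)
    fun _ => SpinWave.isIsland_of_mem_islands hα' hS hsep hρN h0 hQ
  have hsum := SpinWave.hasSum_card_separatedSquares (α := α) hS h0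
  refine ⟨a, fun ρ' hρ' i hi j hj => hconst i j ⟨ρ', hρ', hi, hj⟩, fun p hp => ?_,
    fun ρ' hρ' hne h => SpinWave.disjoint_support_of_notMem_smaller hα' hsep hρN hρ' hne h hc hsupp,
    SpinWave.support_laplacian_subset_D hG hsupp, hsum.summable, by rwa [hsum.tsum_eq]⟩
  exact (Nat.lt_add_of_pos_right two_pos).trans_le (hsupp p hp)

theorem proposition2p4 (α : ℝ) (hα₁ : 3 / 2 < α) (hα₂ : α < 2) :
    ∃ D₃ : ℝ, 0 < D₃ ∧
      ∀ (bc : SpinWave.BoundaryCondition) (L : ℕ), 1 < L →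
      (bc = SpinWave.BoundaryCondition.periodic → Even L) →
      ∀ (β : ℝ), 0 < β →
      ∀ (center : (Fin L × Fin L → ℤ) → Fin L × Fin L),
      SpinWave.IsCenterChoice (SpinWave.squareDomain bc L) center →
      ∀ (S : ℕ → (Fin L × Fin L → ℤ) → Finset (Finset (Fin L × Fin L))),
      SpinWave.IsMinimalCoverChoice bc L S →
      ∀ (N : Finset (Fin L × Fin L → ℤ)),
      SpinWave.IsEnsemble N →
      SpinWave.IsSeparated (SpinWave.squareDomain bc L) α N →
      ∀ ρ ∈ SpinWave.neutral N, ∃ a : Fin L × Fin L → ℝ,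
        (∀ ρ' ∈ SpinWave.smaller (SpinWave.squareDomain bc L) (SpinWave.neutral N) ρ,
          ∀ i ∈ SpinWave.DPlus (SpinWave.squareDomain bc L) center ρ',
          ∀ j ∈ SpinWave.DPlus (SpinWave.squareDomain bc L) center ρ', a i = a j) ∧
        Function.support a ⊆ SpinWave.D (SpinWave.squareDomain bc L) center ρ ∧
        (∀ ρ' ∈ SpinWave.neutral N, ρ' ≠ ρ →
          ρ' ∉ SpinWave.smaller (SpinWave.squareDomain bc L) (SpinWave.neutral N) ρ →
          Disjoint (Function.support a) (Function.support ρ')) ∧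
        Function.support (SpinWave.laplacian (SpinWave.squareDomain bc L) a) ⊆
          SpinWave.D (SpinWave.squareDomain bc L) center ρ ∧
        Summable (fun k : ℕ =>
          ((SpinWave.separatedSquares (SpinWave.squareDomain bc L) α (k + 1)
            (S (k + 1) ρ)).card : ℝ)) ∧
        1 / β * (1 / 16 * SpinWave.norm₂ ρ ^ 2 +
            D₃ * ∑' k : ℕ, ((SpinWave.separatedSquares (SpinWave.squareDomain bc L) α (k + 1)
              (S (k + 1) ρ)).card : ℝ)) ≤
          SpinWave.energy (SpinWave.squareDomain bc L) β a ρ := by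
  obtain ⟨D₃, hD₃, H⟩ := proposition2p4_general
  exact ⟨D₃, hD₃, fun bc L _ heven =>
    H α hα₁.le bc L (by rintro hbc rfl; exact absurd (heven hbc) (by decide))⟩
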